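/- Let $n\ge 5$ be an integer and let $p>\frac{n+4}{n-4}$ be real. There is a constant $C=C(n,p)>0$ such that the following holds for every $m\ge 1$, every $x_0\in\mathbb R^n$ and every classical solution $u=(u_1,\dots,u_m)\in C^4(\mathbb R^n;\mathbb R^m)$ of $$\Delta^2u_i=|u|^{p-1}u_i\quad\text{in }\mathbb R^n,\qquad 1\le i\le m,$$ where $|u|$ is the Euclidean norm of $(u_1,\dots,u_m)$. Put $r=|x-x_0|$, let $\partial_r=\frac{x-x_0}{r}\cdot\nabla$ be the radial derivative, write $B_\lambda=B_\lambda(x_0)$, and for $\lambda>0$ let $$\begin{aligned} E_2(u,\lambda,x_0)={}&\lambda^{4\frac{p+1}{p-1}-n}\int_{B_\lambda}\Big(\frac12\sum_{i=1}^m|\Delta u_i|^2-\frac1{p+1}|u|^{p+1}\Big)\\ &-\frac{2}{p-1}\Big(\frac{p+3}{p-1}-n+1\Big)\lambda^{1+\frac8{p-1}-n}\int_{\partial B_\lambda}|u|^2\\ &-\frac{2}{p-1}\Big(\frac{p+3}{p-1}-n+1\Big)\frac{d}{d\lambda}\Big[\lambda^{\frac8{p-1}+2-n}\int_{\partial B_\lambda}|u|^2\Big]\\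 &+\frac12\lambda^3\frac{d}{d\lambda}\Big[\lambda^{\frac8{p-1}+1-n}\int_{\partial B_\lambda}\sum_{i=1}^m\Big(\frac4{p-1}\lambda^{-1}u_i+\partial_ru_i\Big)^2\Big]\\ &+\frac12\frac{d}{d\lambda}\Big[\lambda^{4\frac{p+1}{p-1}-n}\int_{\partial B_\lambda}\sum_{i=1}^m\big(|\nabla u_i|^2-|\partial_ru_i|^2\big)\Big]\\ &+\frac12\lambda^{4\frac{p+1}{p-1}-n-1}\int_{\partial B_\lambda}\sum_{i=1}^m\big(|\nabla u_i|^2-|\partial_ru_i|^2\big). \end{aligned}$$ Then, for every $\lambda>0$, the three $\lambda$-derivatives in this definition exist, $E_2(u,\cdot,x_0)$ is differentiable at $\lambda$, and $$\frac{dE_2(u,\lambda,x_0)}{d\lambda}\ \ge\ C\,\lambda^{\frac8{p-1}+2-n}\int_{\partial B_\lambda}\sum_{i=1}^m\Big(\frac4{p-1}\,r^{-1}u_i+\partial_ru_i\Big)^2 .$$ In particular $\lambda\mapsto E_2(u,\lambda,x_0)$ is nondecreasing on $(0,\infty)$. -/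

import Mathlib

open MeasureTheory Metric Set
open scoped Laplacian

noncomputable section

namespace LaneEmden

/-- The Euclidean space of dimension `k`. -/
abbrev E (k : ℕ) : Type := EuclideanSpace ℝ (Fin k)

/-- The `i`-th component `u_i` of a vector-valued map `u = (u_1, …, u_m)`. -/
def comp {n m : ℕ} (u : E n → E m) (i : Fin m) : E n → ℝ := fun x => u x i

/-- `u` is a classical solution on the whole of `ℝⁿ` of the fourth order Lane-Emden system
`Δ² u_i = |u|^(p-1) u_i`, `1 ≤ i ≤ m`, where `|u|` is the Euclidean norm of `(u_1, …, u_m)`. -/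
structure IsClassicalSolution {n m : ℕ} (p : ℝ) (u : E n → E m) : Prop where
  contDiff : ContDiff ℝ 4 u
  eqn : ∀ (i : Fin m) (x : E n), Δ (Δ (comp u i)) x = ‖u x‖ ^ (p - 1) * comp u i x

/-- The integral `∫_{∂B_ρ(x₀)} f dσ` with respect to the surface measure `σ` of the sphere of
radius `ρ > 0` about `x₀`, pulled back to the unit sphere by `ω ↦ x₀ + ρ ω`. The measure
`volume.toSphere` is the surface measure of the unit sphere (total mass `n` times the volume
of the unit ball). -/
def sphereIntegral {n : ℕ} (x₀ : E n) (ρ : ℝ) (f : E n → ℝ) : ℝ :=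
  ρ ^ (n - 1) *
    ∫ ω : sphere (0 : E n) 1, f (x₀ + ρ • (ω : E n)) ∂(volume : Measure (E n)).toSphere

/-- The radial derivative `∂f/∂r` about the centre `x₀`, with `r = |x - x₀|`. -/
def radialDeriv {n : ℕ} (x₀ : E n) (f : E n → ℝ) (x : E n) : ℝ :=
  fderiv ℝ f x (‖x - x₀‖⁻¹ • (x - x₀))

/-- `∑ i, ((4 / (p - 1)) r⁻¹ u_i + ∂u_i/∂r)²` with `r = |x - x₀|`. -/
def homogeneityDefect {n m : ℕ} (p : ℝ) (u : E n → E m) (x₀ x : E n) : ℝ :=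
  ∑ i, (4 / (p - 1) * ‖x - x₀‖⁻¹ * comp u i x + radialDeriv x₀ (comp u i) x) ^ 2

/-- `∑ i, (|∇u_i|² - |∂u_i/∂r|²)`. -/
def tangentialDensity {n m : ℕ} (u : E n → E m) (x₀ x : E n) : ℝ :=
  ∑ i, (‖gradient (comp u i) x‖ ^ 2 - radialDeriv x₀ (comp u i) x ^ 2)

/-- `λ^(8/(p-1)+2-n) ∫_{∂B_λ(x₀)} |u|²`. -/
def massTerm {n m : ℕ} (p : ℝ) (u : E n → E m) (x₀ : E n) (ρ : ℝ) : ℝ :=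
  ρ ^ (8 / (p - 1) + 2 - n) * sphereIntegral x₀ ρ (fun x => ‖u x‖ ^ 2)

/-- `λ^(8/(p-1)+1-n) ∫_{∂B_λ(x₀)} ∑ i, ((4 / (p - 1)) λ⁻¹ u_i + ∂u_i/∂r)²`. -/
def defectTerm {n m : ℕ} (p : ℝ) (u : E n → E m) (x₀ : E n) (ρ : ℝ) : ℝ :=
  ρ ^ (8 / (p - 1) + 1 - n) * sphereIntegral x₀ ρ (homogeneityDefect p u x₀)

/-- `λ^(4(p+1)/(p-1)-n) ∫_{∂B_λ(x₀)} ∑ i, (|∇u_i|² - |∂u_i/∂r|²)`. -/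
def tangentialTerm {n m : ℕ} (p : ℝ) (u : E n → E m) (x₀ : E n) (ρ : ℝ) : ℝ :=
  ρ ^ (4 * ((p + 1) / (p - 1)) - n) * sphereIntegral x₀ ρ (tangentialDensity u x₀)

/-- The energy `E₂(u, λ, x₀)`, written with `ρ` for `λ`. -/
def energy₂ {n m : ℕ} (p : ℝ) (u : E n → E m) (x₀ : E n) (ρ : ℝ) : ℝ :=
  ρ ^ (4 * ((p + 1) / (p - 1)) - n) *
      (∫ x in ball x₀ ρ,
        ((1 / 2) * ∑ i, (Δ (comp u i) x) ^ 2 - 1 / (p + 1) * ‖u x‖ ^ (p + 1)))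
    - 2 / (p - 1) * ((p + 3) / (p - 1) - n + 1) *
        (ρ ^ (1 + 8 / (p - 1) - n) * sphereIntegral x₀ ρ (fun x => ‖u x‖ ^ 2))
    - 2 / (p - 1) * ((p + 3) / (p - 1) - n + 1) * deriv (massTerm p u x₀) ρ
    + (1 / 2) * ρ ^ 3 * deriv (defectTerm p u x₀) ρ
    + (1 / 2) * deriv (tangentialTerm p u x₀) ρ
    + (1 / 2) * (ρ ^ (4 * ((p + 1) / (p - 1)) - n - 1) *
        sphereIntegral x₀ ρ (tangentialDensity u x₀))

end LaneEmden

end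

/-! Put `k = 4/(p-1)`, the exponent for which `λ^k u(x₀ + λ(x - x₀))` is again a solution, and let
`D = k + (x - x₀)·∇` generate this scaling. Write ⟨f, g⟩ for `r^(2k)` times the integral of `fg`
over the directions, summed over components. Then `r d/dr` ⟨f, g⟩ = ⟨Df, g⟩ + ⟨f, Dg⟩, so radial
derivatives become algebra. The spherical Laplacian `L` commutes with `D`, is symmetric and
nonpositive for the pairing, and satisfies `r²Δ = D² + αD + β + L` with `α = n - 2 - 2k`, `β = k(k -
(n - 2))`.

On solutions the density `F = ½|Δu|² - |u|^(p+1)/(p+1)` satisfies `(4 + 2k)F + (x - x₀)·∇F = Δu·ΔDu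
- Du·Δ²u`. Green's second identity thus makes the derivative of `λ^(4+2k-n) ∫ F` a boundary term
(`hasDerivAt_scaled_integral_ball`), which the decomposition of `r²Δ` turns into pairings of `u`, `w
= Du`, `Dw`, `D²w`, `Lu` and `Lw` (`angularIntegral_wronskian_laplacian`). The remaining terms of
the energy add up to ⟨w, Dw⟩ - ⟨w, w⟩ - β(⟨u, w⟩ + ⟨u, u⟩) - ⟨w, Lu⟩ - ⟨u, Lu⟩ (`energy₂_eq`), and
their derivative cancels every term without a sign. What is left (`hasDerivAt_energy₂`) is `r E₂'` =
2⟨Dw, Dw⟩ + 2(α - β)⟨w, w⟩ - 2⟨w, Lw⟩. The assumption on `p` says `2k < n - 4`, so `α > 0 > β` and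
`C = 2(α - β)` works, since `w = r(k r⁻¹u + ∂_r u)`.

No charts and no divergence theorem are needed: `L` is half the sum of the squares of the rotation
fields, each of which integrates to zero over spheres by rotation invariance. This gives Green's
formula on spheres, and differentiation in the radius gives what is needed on balls. -/

noncomputable section

namespace LaneEmden

/-! ### Pointwise calculus of dilations, rotations and the spherical Laplacian -/

section SphericalCalculus

variable {n : ℕ} {x₀ : E n}

/-- The Euler operator `f ↦ (x - x₀) · ∇f`. -/
def euler (x₀ : E n) (f : E n → ℝ) (x : E n) : ℝ := fderiv ℝ f x (x - x₀)

/-- The partial derivative in the `i`-th coordinate direction. -/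
def pderiv (i : Fin n) (f : E n → ℝ) (x : E n) : ℝ :=
  fderiv ℝ f x (EuclideanSpace.single i 1)

/-- The generator `y_i ∂_j - y_j ∂_i` of the rotations in the `(i, j)`-plane, `y = x - x₀`. -/
def rotDeriv (x₀ : E n) (i j : Fin n) (f : E n → ℝ) (x : E n) : ℝ :=
  (x i - x₀ i) * pderiv j f x - (x j - x₀ j) * pderiv i f x

/-- The Laplace-Beltrami operator of the unit sphere, acting on functions on the whole space
along the spheres about `x₀`. -/
def sphLaplacian (x₀ : E n) (f : E n → ℝ) (x : E n) : ℝ :=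
  ‖x - x₀‖ ^ 2 * Δ f x - euler x₀ (euler x₀ f) x - ((n : ℝ) - 2) * euler x₀ f x

/-- The carré du champ of `sphLaplacian`. -/
def sphGamma (x₀ : E n) (f g : E n → ℝ) (x : E n) : ℝ :=
  ‖x - x₀‖ ^ 2 * ∑ i, pderiv i f x * pderiv i g x - euler x₀ f x * euler x₀ g x

theorem contDiff_euler {a b : WithTop ℕ∞} {f : E n → ℝ} (hf : ContDiff ℝ a f) (h : b + 1 ≤ a) :
    ContDiff ℝ b (euler x₀ f) :=
  (hf.fderiv_right h).clm_apply (contDiff_id.sub contDiff_const)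

theorem contDiff_pderiv {a b : WithTop ℕ∞} {f : E n → ℝ} (hf : ContDiff ℝ a f) (h : b + 1 ≤ a)
    (i : Fin n) : ContDiff ℝ b (pderiv i f) :=
  (hf.fderiv_right h).clm_apply contDiff_const

theorem contDiff_coord {a : WithTop ℕ∞} (i : Fin n) : ContDiff ℝ a fun x : E n => x i - x₀ i :=
  (contDiff_euclidean.1 contDiff_id i).sub contDiff_const

theorem contDiff_rotDeriv {a b : WithTop ℕ∞} {f : E n → ℝ} (hf : ContDiff ℝ a f) (h : b + 1 ≤ a)
    (i j : Fin n) : ContDiff ℝ b (rotDeriv x₀ i j f) :=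
  ((contDiff_coord i).mul (contDiff_pderiv hf h j)).sub
    ((contDiff_coord j).mul (contDiff_pderiv hf h i))

theorem sum_smul_single (y : E n) : ∑ i, y i • (EuclideanSpace.single i (1 : ℝ) : E n) = y := by
  ext j
  simp [Finset.sum_apply, Pi.single_apply]

theorem euler_eq_sum (f : E n → ℝ) (x : E n) :
    euler x₀ f x = ∑ i, (x i - x₀ i) * pderiv i f x := by
  unfold euler pderiv
  conv_lhs => rw [← sum_smul_single (x - x₀)]
  simp [map_sum]

theorem laplacian_eq_sum {f : E n → ℝ} (hf : ContDiff ℝ 2 f) (x : E n) :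
    Δ f x = ∑ i, pderiv i (pderiv i f) x := by
  rw [InnerProductSpace.laplacian_eq_iteratedFDeriv_orthonormalBasis f
    (EuclideanSpace.basisFun (Fin n) ℝ)]
  refine Finset.sum_congr rfl fun i _ => ?_
  have h : DifferentiableAt ℝ (fderiv ℝ f) x :=
    ((hf.fderiv_right (m := 1) (by norm_num)).differentiable (by norm_num)) x
  unfold pderiv
  rw [iteratedFDeriv_two_apply, fderiv_clm_apply h (differentiableAt_const _)]
  simp

theorem contDiff_laplacian {a b : WithTop ℕ∞} {f : E n → ℝ} (hf : ContDiff ℝ a f)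
    (h : b + 1 + 1 ≤ a) : ContDiff ℝ b (Δ f) := by
  have h2 : ContDiff ℝ 2 f := hf.of_le (le_trans (by
    have : (0 : WithTop ℕ∞) ≤ b := zero_le
    calc (2 : WithTop ℕ∞) = 0 + 1 + 1 := by norm_num
      _ ≤ b + 1 + 1 := by gcongr) h)
  have : Δ f = fun x => ∑ i, pderiv i (pderiv i f) x := funext (laplacian_eq_sum h2)
  rw [this]
  exact ContDiff.sum fun i _ => contDiff_pderiv (contDiff_pderiv hf h i) le_rfl i

theorem pderiv_comm {f : E n → ℝ} (hf : ContDiff ℝ 2 f) (i j : Fin n) (x : E n) :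
    pderiv i (pderiv j f) x = pderiv j (pderiv i f) x := by
  have h : DifferentiableAt ℝ (fderiv ℝ f) x :=
    ((hf.fderiv_right (m := 1) (by norm_num)).differentiable (by norm_num)) x
  have hs : IsSymmSndFDerivAt ℝ f x :=
    hf.contDiffAt.isSymmSndFDerivAt (by simp)
  unfold pderiv
  rw [fderiv_clm_apply h (differentiableAt_const _), fderiv_clm_apply h (differentiableAt_const _)]
  simpa using hs _ _

theorem pderiv_coord (i j : Fin n) (x : E n) :
    pderiv i (fun x : E n => x j - x₀ j) x = if i = j then 1 else 0 := by
  have : HasFDerivAt (fun x : E n => x j - x₀ j) (EuclideanSpace.proj j : E n →L[ℝ] ℝ) x :=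
    (EuclideanSpace.proj j : E n →L[ℝ] ℝ).hasFDerivAt.sub_const _
  rw [pderiv, this.fderiv]
  simp [eq_comm]

theorem pderiv_mul {f g : E n → ℝ} {x : E n} (hf : DifferentiableAt ℝ f x)
    (hg : DifferentiableAt ℝ g x) (i : Fin n) :
    pderiv i (fun x => f x * g x) x = pderiv i f x * g x + f x * pderiv i g x := by
  unfold pderiv
  rw [fderiv_fun_mul hf hg]
  simp; ring

theorem pderiv_sub {f g : E n → ℝ} {x : E n} (hf : DifferentiableAt ℝ f x)
    (hg : DifferentiableAt ℝ g x) (i : Fin n) :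
    pderiv i (fun x => f x - g x) x = pderiv i f x - pderiv i g x := by
  unfold pderiv
  rw [fderiv_fun_sub hf hg]
  simp

theorem pderiv_sum {ι : Type*} {s : Finset ι} {f : ι → E n → ℝ} {x : E n}
    (hf : ∀ j ∈ s, DifferentiableAt ℝ (f j) x) (i : Fin n) :
    pderiv i (fun x => ∑ j ∈ s, f j x) x = ∑ j ∈ s, pderiv i (f j) x := by
  unfold pderiv
  rw [fderiv_fun_sum hf]
  simp

theorem euler_add {f g : E n → ℝ} (hf : Differentiable ℝ f)
    (hg : Differentiable ℝ g) (x : E n) :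
    euler x₀ (fun x => f x + g x) x = euler x₀ f x + euler x₀ g x := by
  unfold euler
  rw [fderiv_fun_add (hf x) (hg x)]
  simp

theorem euler_const_mul {f : E n → ℝ} (c : ℝ) (hf : Differentiable ℝ f) (x : E n) :
    euler x₀ (fun x => c * f x) x = c * euler x₀ f x := by
  unfold euler
  rw [fderiv_const_mul (hf x)]
  simp

theorem euler_mul {f g : E n → ℝ} (hf : Differentiable ℝ f)
    (hg : Differentiable ℝ g) (x : E n) :
    euler x₀ (fun x => f x * g x) x = euler x₀ f x * g x + f x * euler x₀ g x := by
  unfold euler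
  rw [fderiv_fun_mul (hf x) (hg x)]
  simp; ring

theorem euler_sum {ι : Type*} {s : Finset ι} {f : ι → E n → ℝ}
    (hf : ∀ j ∈ s, Differentiable ℝ (f j)) (x : E n) :
    euler x₀ (fun x => ∑ j ∈ s, f j x) x = ∑ j ∈ s, euler x₀ (f j) x := by
  unfold euler
  rw [fderiv_fun_sum fun j hj => hf j hj x]
  simp

theorem pderiv_euler {f : E n → ℝ} (hf : ContDiff ℝ 2 f) (i : Fin n) (x : E n) :
    pderiv i (euler x₀ f) x = pderiv i f x + euler x₀ (pderiv i f) x := by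
  have hd : ∀ j, DifferentiableAt ℝ (pderiv j f) x := fun j =>
    (contDiff_pderiv (b := 1) hf (by norm_num) j).differentiable (by norm_num) x
  have hc : ∀ j, DifferentiableAt ℝ (fun x : E n => x j - x₀ j) x := fun j =>
    (contDiff_coord (a := 1) j).differentiable (by norm_num) x
  rw [show euler x₀ f = fun x => ∑ j, (x j - x₀ j) * pderiv j f x from
    funext (euler_eq_sum f), pderiv_sum fun j _ => (hc j).fun_mul (hd j), euler_eq_sum]
  simp only [fun j => pderiv_mul (hc j) (hd j) i, pderiv_coord, Finset.sum_add_distrib,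
    fun j => pderiv_comm hf i j x]
  simp

/-- Each `∂_i` has commutator `∂_i` with the Euler operator, and `∂_i²` collects it twice. -/
theorem laplacian_euler {f : E n → ℝ} (hf : ContDiff ℝ 3 f) (x : E n) :
    Δ (euler x₀ f) x = euler x₀ (Δ f) x + 2 * Δ f x := by
  have h2 : ContDiff ℝ 2 f := hf.of_le (by norm_num)
  have hp : ∀ i, ContDiff ℝ 2 (pderiv i f) := contDiff_pderiv hf (by norm_num)
  have hpp : ∀ i, ContDiff ℝ 1 (pderiv i (pderiv i f)) := fun i =>
    contDiff_pderiv (hp i) (by norm_num) i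
  rw [laplacian_eq_sum (contDiff_euler hf (by norm_num)), laplacian_eq_sum h2,
    show Δ f = fun x => ∑ i, pderiv i (pderiv i f) x from funext (laplacian_eq_sum h2),
    euler_sum fun i _ => (hpp i).differentiable (by norm_num), Finset.mul_sum,
    ← Finset.sum_add_distrib]
  refine Finset.sum_congr rfl fun i _ => ?_
  have h1 : pderiv i (euler x₀ f) = fun x => pderiv i f x + euler x₀ (pderiv i f) x :=
    funext (pderiv_euler h2 i)
  have h3 : pderiv i (fun x => pderiv i f x + euler x₀ (pderiv i f) x) x =
      pderiv i (pderiv i f) x + pderiv i (euler x₀ (pderiv i f)) x := by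
    unfold pderiv
    rw [fderiv_fun_add]
    · simp
    · exact (hp i).differentiable (by norm_num) x
    · exact (contDiff_euler (b := 1) (hp i) (by norm_num)).differentiable (by norm_num) x
  rw [h1, h3, pderiv_euler (hp i)]
  ring

theorem norm_sub_sq_eq_sum (x : E n) : ‖x - x₀‖ ^ 2 = ∑ i, (x i - x₀ i) ^ 2 := by
  simp [EuclideanSpace.norm_sq_eq]

theorem contDiff_norm_sub_sq {a : WithTop ℕ∞} : ContDiff ℝ a fun x : E n => ‖x - x₀‖ ^ 2 :=
  (contDiff_id.sub contDiff_const).norm_sq ℝ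

theorem euler_norm_sub_sq (x : E n) :
    euler x₀ (fun x => ‖x - x₀‖ ^ 2) x = 2 * ‖x - x₀‖ ^ 2 := by
  have h : HasFDerivAt (fun x : E n => x - x₀) (ContinuousLinearMap.id ℝ (E n)) x :=
    (hasFDerivAt_id x).sub_const x₀
  rw [euler, h.norm_sq.fderiv]
  simp only [_root_.smul_apply, ContinuousLinearMap.comp_apply,
    ContinuousLinearMap.id_apply, innerSL_apply_apply, real_inner_self_eq_norm_sq, nsmul_eq_mul,
    Nat.cast_ofNat]

theorem contDiff_sphLaplacian {a b : WithTop ℕ∞} {f : E n → ℝ} (hf : ContDiff ℝ a f)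
    (h : b + 1 + 1 ≤ a) : ContDiff ℝ b (sphLaplacian x₀ f) := by
  have h1 : ContDiff ℝ (b + 1) (euler x₀ f) := contDiff_euler hf h
  exact ((contDiff_norm_sub_sq.mul (contDiff_laplacian hf h)).sub
    (contDiff_euler h1 le_rfl)).sub (contDiff_const.mul (h1.of_le le_self_add))

/-- The term `2Δf` from the commutator of `Δ` is matched by the derivative of the factor `|x -
x₀|²`, which is homogeneous of degree two. -/
theorem sphLaplacian_euler {f : E n → ℝ} (hf : ContDiff ℝ 3 f) (x : E n) :
    sphLaplacian x₀ (euler x₀ f) x = euler x₀ (sphLaplacian x₀ f) x := by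
  have h1 : ContDiff ℝ 2 (euler x₀ f) := contDiff_euler hf (by norm_num)
  have h2 : ContDiff ℝ 1 (euler x₀ (euler x₀ f)) := contDiff_euler h1 (by norm_num)
  have h3 : ContDiff ℝ 1 (Δ f) := contDiff_laplacian hf (by norm_num)
  have hr : Differentiable ℝ fun x : E n => ‖x - x₀‖ ^ 2 :=
    (contDiff_norm_sub_sq (a := 1)).differentiable (by norm_num)
  have d1 := h1.differentiable (by norm_num)
  have d2 := h2.differentiable (by norm_num)
  have d3 := h3.differentiable (by norm_num)
  have key : sphLaplacian x₀ f = fun x => ‖x - x₀‖ ^ 2 * Δ f x +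
      ((-1) * euler x₀ (euler x₀ f) x + (-((n : ℝ) - 2)) * euler x₀ f x) := by
    funext y; unfold sphLaplacian; ring
  rw [key, euler_add (hr.fun_mul d3) ((d2.const_mul _).fun_add (d1.const_mul _)), euler_mul hr d3,
    euler_add (d2.const_mul _) (d1.const_mul _), euler_const_mul _ d2, euler_const_mul _ d1,
    euler_norm_sub_sq, sphLaplacian, laplacian_euler hf]
  ring

theorem sphLaplacian_add {f g : E n → ℝ} (hf : ContDiff ℝ 2 f) (hg : ContDiff ℝ 2 g) (x : E n) :
    sphLaplacian x₀ (fun x => f x + g x) x = sphLaplacian x₀ f x + sphLaplacian x₀ g x := by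
  have d {h : E n → ℝ} (hh : ContDiff ℝ 2 h) : Differentiable ℝ h :=
    hh.differentiable (by norm_num)
  have de {h : E n → ℝ} (hh : ContDiff ℝ 2 h) : Differentiable ℝ (euler x₀ h) :=
    (contDiff_euler (b := 1) hh (by norm_num)).differentiable (by norm_num)
  have h1 : Δ (fun x => f x + g x) x = Δ f x + Δ g x :=
    hf.contDiffAt.laplacian_add hg.contDiffAt
  unfold sphLaplacian
  rw [h1, funext (euler_add (x₀ := x₀) (d hf) (d hg)), euler_add (de hf) (de hg)]
  ring

theorem laplacian_const_mul {f : E n → ℝ} (c : ℝ) (hf : ContDiff ℝ 2 f) (x : E n) :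
    Δ (fun x => c * f x) x = c * Δ f x := 
  InnerProductSpace.laplacian_smul c hf.contDiffAt

theorem sphLaplacian_const_mul {f : E n → ℝ} (c : ℝ) (hf : ContDiff ℝ 2 f) (x : E n) :
    sphLaplacian x₀ (fun x => c * f x) x = c * sphLaplacian x₀ f x := by
  unfold sphLaplacian
  rw [laplacian_const_mul c hf, funext (euler_const_mul (x₀ := x₀) c (hf.differentiable
    (by norm_num))), euler_const_mul c ((contDiff_euler (b := 1) hf
    (by norm_num)).differentiable (by norm_num))]
  ring

theorem rotDeriv_mul {f g : E n → ℝ} {x : E n} (hf : DifferentiableAt ℝ f x)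
    (hg : DifferentiableAt ℝ g x) (i j : Fin n) :
    rotDeriv x₀ i j (fun x => f x * g x) x =
      rotDeriv x₀ i j f x * g x + f x * rotDeriv x₀ i j g x := by
  unfold rotDeriv
  rw [pderiv_mul hf hg, pderiv_mul hf hg]
  ring

/-- Lagrange's identity for the vectors `x - x₀`, `∇f`, `∇g`; the factor 2 appears because each
plane is counted as `(i, j)` and `(j, i)`. -/
theorem sum_rotDeriv_mul_rotDeriv (f g : E n → ℝ) (x : E n) :
    ∑ i, ∑ j, rotDeriv x₀ i j f x * rotDeriv x₀ i j g x = 2 * sphGamma x₀ f g x := by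
  have e : ∀ i j, rotDeriv x₀ i j f x * rotDeriv x₀ i j g x =
      (x i - x₀ i) ^ 2 * (pderiv j f x * pderiv j g x)
      + (pderiv i f x * pderiv i g x) * (x j - x₀ j) ^ 2
      - (((x i - x₀ i) * pderiv i g x) * ((x j - x₀ j) * pderiv j f x)
        + ((x i - x₀ i) * pderiv i f x) * ((x j - x₀ j) * pderiv j g x)) := by
    intro i j; unfold rotDeriv; ring
  simp only [e, Finset.sum_add_distrib, Finset.sum_sub_distrib, ← Finset.mul_sum,
    ← Finset.sum_mul, ← euler_eq_sum, ← norm_sub_sq_eq_sum, sphGamma]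
  ring

theorem rotDeriv_rotDeriv {f : E n → ℝ} (hf : ContDiff ℝ 2 f) (i j : Fin n) (x : E n) :
    rotDeriv x₀ i j (rotDeriv x₀ i j f) x =
      (x i - x₀ i) * ((if i = j then pderiv j f x else 0) + (x i - x₀ i) * pderiv j (pderiv j f) x
        - (pderiv i f x + (x j - x₀ j) * pderiv j (pderiv i f) x))
      - (x j - x₀ j) * (pderiv j f x + (x i - x₀ i) * pderiv j (pderiv i f) x
        - ((if i = j then pderiv i f x else 0) + (x j - x₀ j) * pderiv i (pderiv i f) x)) := by
  have hd : ∀ j, DifferentiableAt ℝ (pderiv j f) x := fun j =>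
    (contDiff_pderiv (b := 1) hf (by norm_num) j).differentiable (by norm_num) x
  have hc : ∀ j, DifferentiableAt ℝ (fun x : E n => x j - x₀ j) x := fun j =>
    (contDiff_coord (a := 1) j).differentiable (by norm_num) x
  have h : ∀ l, pderiv l (rotDeriv x₀ i j f) x =
      (if l = i then 1 else 0) * pderiv j f x + (x i - x₀ i) * pderiv l (pderiv j f) x
      - ((if l = j then 1 else 0) * pderiv i f x + (x j - x₀ j) * pderiv l (pderiv i f) x) := by
    intro l
    unfold rotDeriv
    rw [pderiv_sub ((hc i).fun_mul (hd j)) ((hc j).fun_mul (hd i)), pderiv_mul (hc i) (hd j),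
      pderiv_mul (hc j) (hd i), pderiv_coord, pderiv_coord]
  rw [rotDeriv, h, h, pderiv_comm hf i j]
  by_cases hij : i = j
  · subst hij; simp
  · simp [hij, Ne.symm hij]

theorem euler_euler {f : E n → ℝ} (hf : ContDiff ℝ 2 f) (x : E n) :
    euler x₀ (euler x₀ f) x = euler x₀ f x +
      ∑ i, ∑ j, (x i - x₀ i) * (x j - x₀ j) * pderiv j (pderiv i f) x := by
  rw [euler_eq_sum (euler x₀ f), euler_eq_sum f, ← Finset.sum_add_distrib]
  refine Finset.sum_congr rfl fun i _ => ?_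
  rw [pderiv_euler hf, euler_eq_sum, mul_add, Finset.mul_sum]
  simp only [mul_assoc]

/-- The spherical Laplacian is the Casimir operator of the rotation group, with each plane again
counted twice. -/
theorem sum_rotDeriv_rotDeriv {f : E n → ℝ} (hf : ContDiff ℝ 2 f) (x : E n) :
    ∑ i, ∑ j, rotDeriv x₀ i j (rotDeriv x₀ i j f) x = 2 * sphLaplacian x₀ f x := by
  have e : ∀ i j, rotDeriv x₀ i j (rotDeriv x₀ i j f) x =
      (if i = j then (x i - x₀ i) * pderiv j f x else 0)
      + (if i = j then (x j - x₀ j) * pderiv i f x else 0)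
      + (x i - x₀ i) ^ 2 * pderiv j (pderiv j f) x + pderiv i (pderiv i f) x * (x j - x₀ j) ^ 2
      - (x i - x₀ i) * pderiv i f x - (x j - x₀ j) * pderiv j f x
      - 2 * ((x i - x₀ i) * (x j - x₀ j) * pderiv j (pderiv i f) x) := by
    intro i j; rw [rotDeriv_rotDeriv hf]; split_ifs <;> ring
  rw [sphLaplacian, euler_euler hf, laplacian_eq_sum hf]
  simp only [e, Finset.sum_add_distrib, Finset.sum_sub_distrib, ← Finset.mul_sum,
    ← Finset.sum_mul, Finset.sum_ite_eq, Finset.mem_univ, if_true, Finset.sum_const,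
    Finset.card_univ, Fintype.card_fin, nsmul_eq_mul, ← euler_eq_sum, ← norm_sub_sq_eq_sum]
  simp only [mul_left_comm _ (n : ℝ), ← Finset.mul_sum, ← euler_eq_sum]
  ring

/-- This exhibits `Γ(f, g) + f L g` as a sum of rotation derivatives, hence as a function with zero
integral over each sphere about `x₀`. -/
theorem sum_rotDeriv_mul {f g : E n → ℝ} (hf : ContDiff ℝ 1 f) (hg : ContDiff ℝ 2 g) (x : E n) :
    ∑ i, ∑ j, rotDeriv x₀ i j (fun x => f x * rotDeriv x₀ i j g x) x =
      2 * (sphGamma x₀ f g x + f x * sphLaplacian x₀ g x) := by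
  have h : ∀ i j, rotDeriv x₀ i j (fun x => f x * rotDeriv x₀ i j g x) x =
      rotDeriv x₀ i j f x * rotDeriv x₀ i j g x
        + f x * rotDeriv x₀ i j (rotDeriv x₀ i j g) x := fun i j =>
    rotDeriv_mul (hf.differentiable (by norm_num) x)
      ((contDiff_rotDeriv (b := 1) hg (by norm_num) i j).differentiable (by norm_num) x) i j
  simp only [h, Finset.sum_add_distrib, ← Finset.mul_sum, sum_rotDeriv_mul_rotDeriv,
    sum_rotDeriv_rotDeriv hg]
  ring

theorem sphGamma_comm (f g : E n → ℝ) (x : E n) : sphGamma x₀ f g x = sphGamma x₀ g f x := by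
  simp only [sphGamma, mul_comm]

theorem sphGamma_self_nonneg (f : E n → ℝ) (x : E n) : 0 ≤ sphGamma x₀ f f x := by
  have h := sum_rotDeriv_mul_rotDeriv (x₀ := x₀) f f x
  have : 0 ≤ ∑ i, ∑ j, rotDeriv x₀ i j f x * rotDeriv x₀ i j f x :=
    Finset.sum_nonneg fun i _ => Finset.sum_nonneg fun j _ => mul_self_nonneg _
  linarith

end SphericalCalculus

/-! ### Integration over spheres: radial derivative, rotation invariance, Green's formula -/

section SphereIntegration

variable {n : ℕ} {x₀ : E n}

/-- The surface measure of the unit sphere. -/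
abbrev sphereMeasure (n : ℕ) : Measure (sphere (0 : E n) 1) := (volume : Measure (E n)).toSphere

/-- The integral of `ω ↦ f (x₀ + r ω)` over the unit sphere. -/
def angularIntegral (x₀ : E n) (f : E n → ℝ) (r : ℝ) : ℝ :=
  ∫ ω : sphere (0 : E n) 1, f (x₀ + r • (ω : E n)) ∂sphereMeasure n

theorem integrable_of_continuous_sphere {f : sphere (0 : E n) 1 → ℝ} (hf : Continuous f) :
    Integrable f (sphereMeasure n) :=
  hf.integrable_of_hasCompactSupport (HasCompactSupport.of_compactSpace _)

/-- Stated for a general family so that it covers both dilations and rotations; compactness of the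
sphere supplies the dominating constant. -/
theorem hasDerivAt_integral_sphere {G : ℝ → E n → ℝ}
    (hG : ContDiff ℝ 1 fun q : ℝ × E n => G q.1 q.2) {G' : ℝ → E n → ℝ}
    (hG' : ∀ t x, HasDerivAt (fun s => G s x) (G' t x) t) (t : ℝ) :
    HasDerivAt (fun s => ∫ ω : sphere (0 : E n) 1, G s ω ∂sphereMeasure n)
      (∫ ω : sphere (0 : E n) 1, G' t ω ∂sphereMeasure n) t := by
  -- `G'` is the partial derivative of the jointly `C¹` map in the direction `(1, 0)`, hence jointly
  -- continuous.
  have hc : Continuous fun q : ℝ × E n => G' q.1 q.2 := by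
    have h1 : (fun q : ℝ × E n => G' q.1 q.2) =
        fun q => fderiv ℝ (fun q : ℝ × E n => G q.1 q.2) q (1, 0) := by
      funext q
      have hd : HasFDerivAt (fun q : ℝ × E n => G q.1 q.2) _ (q.1, q.2) :=
        (hG.differentiable (by norm_num) q).hasFDerivAt
      have h2 : HasDerivAt (fun s : ℝ => (s, q.2)) ((1 : ℝ), (0 : E n)) q.1 :=
        (hasDerivAt_id _).prodMk (hasDerivAt_const _ _)
      have h3 : HasDerivAt (fun s => G s q.2) _ q.1 :=
        HasFDerivAt.comp_hasDerivAt_of_eq q.1 hd h2 rfl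
      exact (hG' q.1 q.2).unique h3
    rw [h1]
    exact (hG.continuous_fderiv (by norm_num)).clm_apply continuous_const
  obtain ⟨C, hC⟩ := ((isCompact_closedBall t 1).prod
    (isCompact_sphere (0 : E n) 1)).exists_bound_of_continuousOn hc.continuousOn
  refine (hasDerivAt_integral_of_dominated_loc_of_deriv_le (μ := sphereMeasure n)
    (F := fun s ω => G s ω) (F' := fun s ω => G' s ω) (s := closedBall t 1)
    (bound := fun _ => C) (closedBall_mem_nhds t one_pos) ?_ ?_ ?_ ?_ (integrable_const C)
    ?_).2
  · exact Filter.Eventually.of_forall fun s => (integrable_of_continuous_sphere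
      (hG.continuous.comp (continuous_const.prodMk continuous_subtype_val))).aestronglyMeasurable
  · exact integrable_of_continuous_sphere
      (hG.continuous.comp (continuous_const.prodMk continuous_subtype_val))
  · exact (integrable_of_continuous_sphere
      (hc.comp (continuous_const.prodMk continuous_subtype_val))).aestronglyMeasurable
  · exact Filter.Eventually.of_forall fun ω s hs => hC (s, ω) ⟨hs, ω.2⟩
  · exact Filter.Eventually.of_forall fun ω s _ => hG' s ω

theorem continuous_sphere_slice {f : E n → ℝ} (hf : Continuous f) (r : ℝ) :
    Continuous fun ω : sphere (0 : E n) 1 => f (x₀ + r • (ω : E n)) :=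
  hf.comp (continuous_const.add (continuous_subtype_val.const_smul r))

theorem integrable_sphere_slice {f : E n → ℝ} (hf : Continuous f) (r : ℝ) :
    Integrable (fun ω : sphere (0 : E n) 1 => f (x₀ + r • (ω : E n))) (sphereMeasure n) :=
  integrable_of_continuous_sphere (continuous_sphere_slice hf r)

theorem angularIntegral_add {f g : E n → ℝ} (hf : Continuous f) (hg : Continuous g) (r : ℝ) :
    angularIntegral x₀ (fun x => f x + g x) r = angularIntegral x₀ f r + angularIntegral x₀ g r :=
  integral_add (integrable_sphere_slice hf r) (integrable_sphere_slice hg r)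

theorem angularIntegral_sub {f g : E n → ℝ} (hf : Continuous f) (hg : Continuous g) (r : ℝ) :
    angularIntegral x₀ (fun x => f x - g x) r = angularIntegral x₀ f r - angularIntegral x₀ g r :=
  integral_sub (integrable_sphere_slice hf r) (integrable_sphere_slice hg r)

theorem angularIntegral_const_mul (f : E n → ℝ) (c r : ℝ) :
    angularIntegral x₀ (fun x => c * f x) r = c * angularIntegral x₀ f r :=
  integral_const_mul _ _

theorem angularIntegral_sum {ι : Type*} {s : Finset ι} {f : ι → E n → ℝ}
    (hf : ∀ i ∈ s, Continuous (f i)) (r : ℝ) :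
    angularIntegral x₀ (fun x => ∑ i ∈ s, f i x) r = ∑ i ∈ s, angularIntegral x₀ (f i) r :=
  integral_finsetSum _ fun i hi => integrable_sphere_slice (hf i hi) r

theorem angularIntegral_nonneg {f : E n → ℝ} (hf : ∀ x, 0 ≤ f x) (r : ℝ) :
    0 ≤ angularIntegral x₀ f r :=
  integral_nonneg fun _ => hf _

theorem angularIntegral_congr {f g : E n → ℝ} {r : ℝ}
    (h : ∀ ω : E n, ‖ω‖ = 1 → f (x₀ + r • ω) = g (x₀ + r • ω)) :
    angularIntegral x₀ f r = angularIntegral x₀ g r :=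
  integral_congr_ae (Filter.Eventually.of_forall fun ω => h ω (by simp))

theorem continuous_angularIntegral {f : E n → ℝ} (hf : Continuous f) :
    Continuous (angularIntegral x₀ f) := by
  have h : Continuous (Function.uncurry fun (r : ℝ) (ω : sphere (0 : E n) 1) =>
      f (x₀ + r • (ω : E n))) := by
    unfold Function.uncurry
    fun_prop
  simpa using! continuous_parametric_integral_of_continuous (μ := sphereMeasure n) h isCompact_univ

theorem hasDerivAt_angularIntegral {f : E n → ℝ} (hf : ContDiff ℝ 1 f) {r : ℝ} (hr : r ≠ 0) :
    HasDerivAt (angularIntegral x₀ f) (r⁻¹ * angularIntegral x₀ (euler x₀ f) r) r := by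
  have h := hasDerivAt_integral_sphere (G := fun t x => f (x₀ + t • x))
    (G' := fun t x => fderiv ℝ f (x₀ + t • x) x) (by fun_prop) (fun t x => by
      have h1 : HasDerivAt (fun s : ℝ => x₀ + s • x) x t := by
        simpa using ((hasDerivAt_id t).smul_const x).const_add x₀
      exact (hf.differentiable (by norm_num) _).hasFDerivAt.comp_hasDerivAt t h1) r
  refine h.congr_deriv ?_
  rw [← angularIntegral_const_mul]
  refine integral_congr_ae (Filter.Eventually.of_forall fun ω => ?_)
  simp [euler, hr]

-- `toSphere` measures a set by the volume of the truncated cone over it, up to a factor; a linear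
-- isometry carries cones to cones and preserves volume.
open scoped Pointwise in
theorem measurePreserving_sphere_isometry (T : E n ≃ₗᵢ[ℝ] E n) :
    MeasurePreserving
      (T.toHomeomorph.subtype (p := (· ∈ sphere (0 : E n) 1)) (q := (· ∈ sphere (0 : E n) 1))
        (fun x => by simp)) (sphereMeasure n) (sphereMeasure n) := by
  set Φ := T.toHomeomorph.subtype (p := (· ∈ sphere (0 : E n) 1)) (q := (· ∈ sphere (0 : E n) 1))
        (fun x => by simp) with hΦ
  have hval : ∀ ω, ((Φ ω : sphere (0 : E n) 1) : E n) = T ω := fun ω => rfl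
  refine ⟨Φ.continuous.measurable, ?_⟩
  ext s hs
  rw [Measure.map_apply Φ.continuous.measurable hs, Measure.toSphere_apply' _ hs,
    Measure.toSphere_apply' _ (Φ.continuous.measurable hs)]
  congr 1
  rw [← T.measurePreserving.measure_preimage_equiv (f := T.toHomeomorph.toMeasurableEquiv)
    (Ioo (0 : ℝ) 1 • (Subtype.val '' s))]
  congr 1
  ext x
  simp only [Set.mem_smul, Set.mem_preimage, Set.mem_image]
  constructor
  · rintro ⟨t, ht, _, ⟨ω, hω, rfl⟩, rfl⟩
    exact ⟨t, ht, _, ⟨Φ ω, hω, rfl⟩, by simp [hval]⟩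
  · rintro ⟨t, ht, _, ⟨ω, hω, rfl⟩, hx⟩
    refine ⟨t, ht, _, ⟨Φ.symm ω, by simpa using hω, rfl⟩, T.injective ?_⟩
    have : T (Φ.symm ω : sphere (0 : E n) 1) = ω := by rw [← hval]; simp
    simp only [map_smul, this]
    exact hx

theorem integral_sphere_comp_isometry (T : E n ≃ₗᵢ[ℝ] E n) (f : E n → ℝ) :
    ∫ ω : sphere (0 : E n) 1, f (T ω) ∂sphereMeasure n =
      ∫ ω : sphere (0 : E n) 1, f ω ∂sphereMeasure n :=
  (measurePreserving_sphere_isometry T).integral_comp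
    (Homeomorph.measurableEmbedding _) (fun ω => f ω)

/-- The rotation by the angle `t` in the `(i, j)`-plane. -/
def planeRotation (i j : Fin n) (t : ℝ) (x : E n) : E n :=
  x + ((Real.cos t - 1) * x i - Real.sin t * x j) • EuclideanSpace.single i (1 : ℝ)
    + ((Real.cos t - 1) * x j + Real.sin t * x i) • EuclideanSpace.single j (1 : ℝ)

theorem norm_planeRotation {i j : Fin n} (hij : i ≠ j) (t : ℝ) (x : E n) :
    ‖planeRotation i j t x‖ = ‖x‖ := by
  rw [← sq_eq_sq₀ (norm_nonneg _) (norm_nonneg _), planeRotation, norm_add_sq_real,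
    norm_add_sq_real]
  simp only [inner_add_left, inner_smul_right, inner_smul_left, norm_smul, mul_pow,
    EuclideanSpace.inner_single_right, PiLp.norm_single,
    PiLp.single_apply, Real.norm_eq_abs, sq_abs]
  simp [Ne.symm hij]
  linear_combination (x i ^ 2 + x j ^ 2) * Real.sin_sq_add_cos_sq t

/-- `planeRotation` as a linear isometry. -/
def planeRotationEquiv {i j : Fin n} (hij : i ≠ j) (t : ℝ) : E n ≃ₗᵢ[ℝ] E n :=
  LinearIsometry.toLinearIsometryEquiv
    { toFun := planeRotation i j t
      map_add' := fun x y => by simp only [planeRotation, PiLp.add_apply]; module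
      map_smul' := fun c x => by
        simp only [planeRotation, PiLp.smul_apply, smul_eq_mul, RingHom.id_apply]; module
      norm_map' := norm_planeRotation hij t } rfl

/-- The integral of `f` composed with the rotation by `t` does not depend on `t`; its derivative at
`t = 0` is the integral of the rotation derivative. -/
theorem angularIntegral_rotDeriv {f : E n → ℝ} (hf : ContDiff ℝ 1 f) (i j : Fin n) (r : ℝ) :
    angularIntegral x₀ (rotDeriv x₀ i j f) r = 0 := by
  by_cases hij : i = j
  · subst hij
    simp [angularIntegral, rotDeriv]
  have hcoord : ∀ l : Fin n, ContDiff ℝ 1 fun q : ℝ × E n => q.2 l := fun l =>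
    contDiff_euclidean.1 contDiff_snd l
  have hrot : ContDiff ℝ 1 fun q : ℝ × E n => planeRotation i j q.1 q.2 := by
    unfold planeRotation
    have h1 := hcoord i
    have h2 := hcoord j
    fun_prop
  have h := hasDerivAt_integral_sphere (G := fun t x => f (x₀ + r • planeRotation i j t x))
    (G' := fun t x => fderiv ℝ f (x₀ + r • planeRotation i j t x) (r •
      (((-Real.sin t) * x i - Real.cos t * x j) • EuclideanSpace.single i (1 : ℝ)
    + ((-Real.sin t) * x j + Real.cos t * x i) • EuclideanSpace.single j (1 : ℝ))))
    (by fun_prop) (fun t x => by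
      have h1 : HasDerivAt (fun s : ℝ => planeRotation i j s x)
          (((-Real.sin t) * x i - Real.cos t * x j) • EuclideanSpace.single i (1 : ℝ)
            + ((-Real.sin t) * x j + Real.cos t * x i) • EuclideanSpace.single j (1 : ℝ)) t := by
        have hs := Real.hasDerivAt_sin t
        have hc := (Real.hasDerivAt_cos t).sub_const 1
        exact ((((hc.mul_const (x i)).sub (hs.mul_const (x j))).smul_const _).const_add x).add
          (((hc.mul_const (x j)).add (hs.mul_const (x i))).smul_const _)
      exact (hf.differentiable (by norm_num) _).hasFDerivAt.comp_hasDerivAt t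
        ((h1.const_smul r).const_add x₀)) 0
  have hconst : (fun s : ℝ => ∫ ω : sphere (0 : E n) 1, f (x₀ + r • planeRotation i j s ω)
      ∂sphereMeasure n) = fun _ => angularIntegral x₀ f r := by
    funext s
    exact integral_sphere_comp_isometry (planeRotationEquiv hij s) fun x => f (x₀ + r • x)
  rw [hconst] at h
  rw [(hasDerivAt_const _ _).unique h]
  refine integral_congr_ae (Filter.Eventually.of_forall fun ω => ?_)
  -- At angle zero the velocity is `ω_i e_j - ω_j e_i`, and `r ω` is the displacement from `x₀`.
  have h0 : planeRotation i j 0 (ω : E n) = ω := by simp [planeRotation]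
  simp only [rotDeriv, pderiv, h0, map_smul, map_add, smul_eq_mul]
  simp
  ring

theorem continuous_sphGamma {f g : E n → ℝ} (hf : ContDiff ℝ 1 f) (hg : ContDiff ℝ 1 g) :
    Continuous (sphGamma x₀ f g) := by
  have hp {f : E n → ℝ} (hf : ContDiff ℝ 1 f) (i : Fin n) : Continuous (pderiv i f) :=
    (contDiff_pderiv (b := 0) hf (by norm_num) i).continuous
  have he {f : E n → ℝ} (hf : ContDiff ℝ 1 f) : Continuous (euler x₀ f) :=
    (contDiff_euler (b := 0) hf (by norm_num)).continuous
  exact ((contDiff_norm_sub_sq (a := 0)).continuous.mul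
    (continuous_finsetSum _ fun i _ => (hp hf i).mul (hp hg i))).sub ((he hf).mul (he hg))

theorem continuous_sphLaplacian {f : E n → ℝ} (hf : ContDiff ℝ 2 f) :
    Continuous (sphLaplacian x₀ f) :=
  (contDiff_sphLaplacian (b := 0) hf (by norm_num)).continuous

/-- Green's formula on the spheres about `x₀`. -/
theorem angularIntegral_mul_sphLaplacian {f g : E n → ℝ} (hf : ContDiff ℝ 1 f)
    (hg : ContDiff ℝ 2 g) (r : ℝ) :
    angularIntegral x₀ (fun x => f x * sphLaplacian x₀ g x) r =
      -angularIntegral x₀ (sphGamma x₀ f g) r := by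
  have hfg : ∀ i j, ContDiff ℝ 1 fun x => f x * rotDeriv x₀ i j g x := fun i j =>
    hf.mul (contDiff_rotDeriv hg (by norm_num) i j)
  have hcont : ∀ i j, Continuous (rotDeriv x₀ i j fun x => f x * rotDeriv x₀ i j g x) :=
    fun i j => (contDiff_rotDeriv (b := 0) (hfg i j) (by norm_num) i j).continuous
  have h : angularIntegral x₀
      (fun x => 2 * (sphGamma x₀ f g x + f x * sphLaplacian x₀ g x)) r = 0 := by
    simp only [← sum_rotDeriv_mul hf hg]
    rw [angularIntegral_sum fun i _ => continuous_finsetSum _ fun j _ => hcont i j]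
    refine Finset.sum_eq_zero fun i _ => ?_
    rw [angularIntegral_sum fun j _ => hcont i j]
    exact Finset.sum_eq_zero fun j _ => angularIntegral_rotDeriv (hfg i j) i j r
  rw [angularIntegral_const_mul, angularIntegral_add (continuous_sphGamma hf
    (hg.of_le (by norm_num))) (hf.continuous.fun_mul (continuous_sphLaplacian hg))] at h
  linarith

theorem angularIntegral_mul_sphLaplacian_comm {f g : E n → ℝ} (hf : ContDiff ℝ 2 f)
    (hg : ContDiff ℝ 2 g) (r : ℝ) :
    angularIntegral x₀ (fun x => f x * sphLaplacian x₀ g x) r =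
      angularIntegral x₀ (fun x => g x * sphLaplacian x₀ f x) r := by
  rw [angularIntegral_mul_sphLaplacian (hf.of_le (by norm_num)) hg,
    angularIntegral_mul_sphLaplacian (hg.of_le (by norm_num)) hf,
    funext (sphGamma_comm (x₀ := x₀) f g)]

/-! ### Polar coordinates and integrals over balls -/

theorem integral_polar {g : E n → ℝ} (hn : 0 < n) (hg : Integrable g) :
    ∫ x, g x = ∫ r in Ioi (0 : ℝ), r ^ (n - 1) * angularIntegral 0 g r := by
  have hdim : Module.finrank ℝ (E n) = n := by simp
  have : Nontrivial (E n) := Module.nontrivial_of_finrank_pos (R := ℝ) (by rw [hdim]; exact hn)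
  have hmp := (volume : Measure (E n)).measurePreserving_homeomorphUnitSphereProd
  have hemb := (homeomorphUnitSphereProd (E n)).measurableEmbedding
  rw [hdim] at hmp
  have hval : ∀ x : ({0}ᶜ : Set (E n)), g x = (fun q : sphere (0 : E n) 1 × Ioi (0 : ℝ) =>
      g ((q.2 : ℝ) • (q.1 : E n))) (homeomorphUnitSphereProd (E n) x) := by
    intro x
    have h := (homeomorphUnitSphereProd (E n)).symm_apply_apply x
    have h' := congrArg (fun y : ({0}ᶜ : Set (E n)) => (y : E n)) h
    simp only [homeomorphUnitSphereProd_symm_apply_coe] at h'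
    simp only [h']
  have hint : Integrable (fun q : sphere (0 : E n) 1 × Ioi (0 : ℝ) => g ((q.2 : ℝ) • (q.1 : E n)))
      ((sphereMeasure n).prod (Measure.volumeIoiPow (n - 1))) := by
    rw [← hmp.integrable_comp_emb hemb]
    have h1 : Integrable (fun x : ({0}ᶜ : Set (E n)) => g x)
        ((volume : Measure (E n)).comap (↑)) := by
      exact (integrableOn_iff_comap_subtypeVal (measurableSet_singleton (0 : E n)).compl).1
        hg.integrableOn
    exact h1.congr (Filter.Eventually.of_forall hval)
  calc ∫ x, g x = ∫ x : ({0}ᶜ : Set (E n)), g x ∂((volume : Measure (E n)).comap (↑)) := by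
        rw [integral_subtype_comap (measurableSet_singleton _).compl g, restrict_compl_singleton]
    _ = ∫ q : sphere (0 : E n) 1 × Ioi (0 : ℝ), g ((q.2 : ℝ) • (q.1 : E n))
          ∂(sphereMeasure n).prod (Measure.volumeIoiPow (n - 1)) := by
        rw [← hmp.integral_comp hemb]
        exact integral_congr_ae (Filter.Eventually.of_forall hval)
    _ = ∫ r : Ioi (0 : ℝ), angularIntegral 0 g r ∂Measure.volumeIoiPow (n - 1) := by
        rw [integral_prod_symm _ hint]
        simp [angularIntegral]
    _ = _ := by
        simp only [Measure.volumeIoiPow, ENNReal.ofReal]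
        rw [integral_withDensity_eq_integral_smul
            (measurable_subtype_coe.pow_const _).real_toNNReal,
          integral_subtype_comap measurableSet_Ioi
            fun a => Real.toNNReal (a ^ (n - 1)) • angularIntegral 0 g a]
        refine setIntegral_congr_fun measurableSet_Ioi fun x hx => ?_
        simp only [NNReal.smul_def, Real.coe_toNNReal _ (pow_nonneg (le_of_lt hx) _), smul_eq_mul]

theorem integral_ball_eq {f : E n → ℝ} (hn : 0 < n) (hf : Continuous f) {ρ : ℝ} (hρ : 0 ≤ ρ) :
    ∫ x in ball x₀ ρ, f x = ∫ r in (0 : ℝ)..ρ, r ^ (n - 1) * angularIntegral x₀ f r := by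
  have h1 : ∫ x in ball x₀ ρ, f x = ∫ x in ball (0 : E n) ρ, f (x₀ + x) := by
    rw [← (measurePreserving_add_left volume x₀).setIntegral_preimage_emb
      (measurableEmbedding_addLeft x₀)]
    simp
  have hint : Integrable ((ball (0 : E n) ρ).indicator fun x => f (x₀ + x)) := by
    rw [integrable_indicator_iff measurableSet_ball]
    exact ((hf.comp (continuous_const.add continuous_id)).continuousOn.integrableOn_compact
      (isCompact_closedBall 0 ρ)).mono_set ball_subset_closedBall
  rw [h1, ← integral_indicator measurableSet_ball, integral_polar hn hint,
    intervalIntegral.integral_of_le hρ, integral_Ioc_eq_integral_Ioo,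
    ← Ioi_inter_Iio, ← setIntegral_indicator measurableSet_Iio]
  refine setIntegral_congr_fun measurableSet_Ioi fun r hr => ?_
  have hr' : (0 : ℝ) < r := hr
  by_cases h : r < ρ
  · rw [indicator_of_mem (show r ∈ Iio ρ from h)]
    congr 1
    refine integral_congr_ae (Filter.Eventually.of_forall fun ω => ?_)
    simp [indicator, norm_smul, abs_of_pos hr', h]
  · rw [indicator_of_notMem (show r ∉ Iio ρ from h)]
    have : angularIntegral 0 ((ball (0 : E n) ρ).indicator fun x => f (x₀ + x)) r = 0 := by
      simp [angularIntegral, indicator, norm_smul, abs_of_pos hr', h]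
    simp [this]

theorem hasDerivAt_integral_ball {f : E n → ℝ} (hn : 0 < n) (hf : Continuous f) {ρ : ℝ}
    (hρ : 0 < ρ) : HasDerivAt (fun ρ => ∫ x in ball x₀ ρ, f x)
      (ρ ^ (n - 1) * angularIntegral x₀ f ρ) ρ := by
  have hc : Continuous fun r : ℝ => r ^ (n - 1) * angularIntegral x₀ f r :=
    (continuous_pow _).mul (continuous_angularIntegral hf)
  refine (intervalIntegral.integral_hasDerivAt_right (hc.intervalIntegrable 0 ρ)
    (hc.stronglyMeasurableAtFilter _ _) hc.continuousAt).congr_of_eventuallyEq ?_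
  filter_upwards [lt_mem_nhds hρ] with s hs
  exact integral_ball_eq hn hf hs.le

theorem sphereIntegral_eq (f : E n → ℝ) (ρ : ℝ) :
    sphereIntegral x₀ ρ f = ρ ^ (n - 1) * angularIntegral x₀ f ρ := rfl

end SphereIntegration

/-! ### The scaling generator, scaled pairings and the boundary term -/

section Scaling

variable {n : ℕ} {x₀ : E n}

/-- The generator `k + (x - x₀) · ∇` of the scalings `f ↦ λ ^ k f(x₀ + λ (x - x₀))`. -/
def scaleDeriv (k : ℝ) (x₀ : E n) (f : E n → ℝ) (x : E n) : ℝ := k * f x + euler x₀ f x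

theorem contDiff_scaleDeriv {a b : WithTop ℕ∞} {k : ℝ} {f : E n → ℝ} (hf : ContDiff ℝ a f)
    (h : b + 1 ≤ a) : ContDiff ℝ b (scaleDeriv k x₀ f) :=
  (contDiff_const.mul (hf.of_le (le_self_add.trans h))).add (contDiff_euler hf h)

theorem scaleDeriv_add {k : ℝ} {f g : E n → ℝ} (hf : Differentiable ℝ f)
    (hg : Differentiable ℝ g) (x : E n) :
    scaleDeriv k x₀ (fun x => f x + g x) x = scaleDeriv k x₀ f x + scaleDeriv k x₀ g x := by
  rw [scaleDeriv, euler_add hf hg, scaleDeriv, scaleDeriv]; ring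

theorem scaleDeriv_const_mul {k : ℝ} {f : E n → ℝ} (c : ℝ) (hf : Differentiable ℝ f) (x : E n) :
    scaleDeriv k x₀ (fun x => c * f x) x = c * scaleDeriv k x₀ f x := by
  rw [scaleDeriv, euler_const_mul c hf, scaleDeriv]; ring

theorem sphLaplacian_scaleDeriv {k : ℝ} {f : E n → ℝ} (hf : ContDiff ℝ 3 f) (x : E n) :
    sphLaplacian x₀ (scaleDeriv k x₀ f) x = scaleDeriv k x₀ (sphLaplacian x₀ f) x := by
  have h2 : ContDiff ℝ 2 f := hf.of_le (by norm_num)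
  unfold scaleDeriv
  rw [sphLaplacian_add (contDiff_const.mul h2) (contDiff_euler hf (by norm_num)),
    sphLaplacian_const_mul k h2, sphLaplacian_euler hf]

theorem laplacian_scaleDeriv {k : ℝ} {f : E n → ℝ} (hf : ContDiff ℝ 3 f) (x : E n) :
    Δ (scaleDeriv k x₀ f) x = (k + 2) * Δ f x + euler x₀ (Δ f) x := by
  have h2 : ContDiff ℝ 2 f := hf.of_le (by norm_num)
  have h1 : Δ (scaleDeriv k x₀ f) x = Δ (fun x => k * f x) x + Δ (euler x₀ f) x :=
    (contDiff_const.mul h2).contDiffAt.laplacian_add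
      (contDiff_euler hf (by norm_num)).contDiffAt
  rw [h1, laplacian_const_mul k h2, laplacian_euler hf]
  ring

/-- The pairing of two functions on the sphere of radius `r`, scaled to the unit sphere. -/
def scaledPairing (k : ℝ) (x₀ : E n) (f g : E n → ℝ) (r : ℝ) : ℝ :=
  r ^ (2 * k) * angularIntegral x₀ (fun x => f x * g x) r

section pairing

variable {k r : ℝ} {f g h : E n → ℝ}

theorem scaledPairing_comm : scaledPairing k x₀ f g r = scaledPairing k x₀ g f r := by
  simp only [scaledPairing, mul_comm]

theorem scaledPairing_add_left (hf : Continuous f) (hg : Continuous g) (hh : Continuous h) :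
    scaledPairing k x₀ (fun x => f x + g x) h r =
      scaledPairing k x₀ f h r + scaledPairing k x₀ g h r := by
  simp only [scaledPairing, add_mul]
  rw [angularIntegral_add (hf.fun_mul hh) (hg.fun_mul hh), mul_add]

theorem scaledPairing_const_mul_left (c : ℝ) :
    scaledPairing k x₀ (fun x => c * f x) g r = c * scaledPairing k x₀ f g r := by
  simp only [scaledPairing, mul_assoc]
  rw [angularIntegral_const_mul]
  ring

theorem scaledPairing_self_nonneg (hr : 0 ≤ r) : 0 ≤ scaledPairing k x₀ f f r :=
  mul_nonneg (Real.rpow_nonneg hr _) (angularIntegral_nonneg (fun _ => mul_self_nonneg _) r)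

theorem scaledPairing_sphLaplacian (hf : ContDiff ℝ 2 f) :
    scaledPairing k x₀ f (sphLaplacian x₀ f) r =
      -(r ^ (2 * k) * angularIntegral x₀ (sphGamma x₀ f f) r) := by
  rw [scaledPairing, angularIntegral_mul_sphLaplacian (hf.of_le (by norm_num)) hf, mul_neg]

theorem scaledPairing_sphLaplacian_nonpos (hf : ContDiff ℝ 2 f) (hr : 0 ≤ r) :
    scaledPairing k x₀ f (sphLaplacian x₀ f) r ≤ 0 := by
  rw [scaledPairing_sphLaplacian hf, neg_nonpos]
  exact mul_nonneg (Real.rpow_nonneg hr _) (angularIntegral_nonneg (sphGamma_self_nonneg f) r)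

theorem scaledPairing_sphLaplacian_comm (hf : ContDiff ℝ 2 f) (hg : ContDiff ℝ 2 g) :
    scaledPairing k x₀ f (sphLaplacian x₀ g) r = scaledPairing k x₀ g (sphLaplacian x₀ f) r := by
  rw [scaledPairing, scaledPairing, angularIntegral_mul_sphLaplacian_comm hf hg]

/-- Differentiating the weight `r^(2k)` produces `2k`; one `k` goes to each factor and completes its
Euler derivative to `scaleDeriv`. -/
theorem hasDerivAt_scaledPairing (hf : ContDiff ℝ 1 f) (hg : ContDiff ℝ 1 g) (hr : 0 < r) :
    HasDerivAt (scaledPairing k x₀ f g) (r⁻¹ * (scaledPairing k x₀ (scaleDeriv k x₀ f) g r +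
      scaledPairing k x₀ f (scaleDeriv k x₀ g) r)) r := by
  have c {f : E n → ℝ} (hf : ContDiff ℝ 1 f) : Continuous (scaleDeriv k x₀ f) :=
    (contDiff_scaleDeriv (b := 0) hf (by norm_num)).continuous
  have h1 := (Real.hasDerivAt_rpow_const (p := 2 * k) (Or.inl hr.ne')).mul
    (hasDerivAt_angularIntegral (x₀ := x₀) (hf.mul hg) hr.ne')
  refine h1.congr_deriv ?_
  have h2 : angularIntegral x₀ (fun x => scaleDeriv k x₀ f x * g x + f x * scaleDeriv k x₀ g x) r
      = 2 * k * angularIntegral x₀ (fun x => f x * g x) r +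
        angularIntegral x₀ (euler x₀ fun x => f x * g x) r := by
    rw [← angularIntegral_const_mul, ← angularIntegral_add
      (continuous_const.fun_mul (hf.continuous.fun_mul hg.continuous))
      (contDiff_euler (b := 0) (hf.mul hg) (by norm_num)).continuous]
    refine angularIntegral_congr fun ω _ => ?_
    rw [euler_mul (hf.differentiable (by norm_num)) (hg.differentiable (by norm_num))]
    unfold scaleDeriv
    ring
  rw [angularIntegral_add ((c hf).fun_mul hg.continuous) (hf.continuous.fun_mul (c hg))] at h2
  rw [scaledPairing, scaledPairing, ← mul_add, h2, Real.rpow_sub_one hr.ne']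
  field_simp

end pairing

/-- Green's second identity on a sphere, differentiated in the radius. -/
theorem angularIntegral_euler_wronskian {f g : E n → ℝ} (hf : ContDiff ℝ 2 f)
    (hg : ContDiff ℝ 2 g) {r : ℝ} :
    ((n : ℝ) - 2) * angularIntegral x₀ (fun x => f x * euler x₀ g x - g x * euler x₀ f x) r +
      angularIntegral x₀ (euler x₀ fun x => f x * euler x₀ g x - g x * euler x₀ f x) r =
    r ^ 2 * angularIntegral x₀ (fun x => f x * Δ g x - g x * Δ f x) r := by
  have ef : ContDiff ℝ 1 (euler x₀ f) := contDiff_euler hf (by norm_num)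
  have eg : ContDiff ℝ 1 (euler x₀ g) := contDiff_euler hg (by norm_num)
  have hf1 : ContDiff ℝ 1 f := hf.of_le (by norm_num)
  have hg1 : ContDiff ℝ 1 g := hg.of_le (by norm_num)
  have hW : ContDiff ℝ 1 fun x => f x * euler x₀ g x - g x * euler x₀ f x :=
    (hf1.mul eg).sub (hg1.mul ef)
  have cL : ∀ {a b : E n → ℝ}, ContDiff ℝ 2 a → ContDiff ℝ 2 b →
      Continuous fun x => a x * sphLaplacian x₀ b x := fun ha hb =>
    ha.continuous.mul (continuous_sphLaplacian hb)
  have d {a : E n → ℝ} (ha : ContDiff ℝ 1 a) : Differentiable ℝ a := ha.differentiable (by norm_num)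
  -- Adding this zero, which is the symmetry of the spherical Laplacian, reduces the claim to a
  -- pointwise identity on the sphere.
  have hzero : angularIntegral x₀
      (fun x => f x * sphLaplacian x₀ g x - g x * sphLaplacian x₀ f x) r = 0 := by
    rw [angularIntegral_sub (cL hf hg) (cL hg hf), angularIntegral_mul_sphLaplacian_comm hf hg,
      sub_self]
  rw [← angularIntegral_const_mul, ← angularIntegral_const_mul, ← angularIntegral_add
    (continuous_const.fun_mul hW.continuous) (contDiff_euler (b := 0) hW (by norm_num)).continuous,
    ← add_zero (angularIntegral x₀ _ r), ← hzero, ← angularIntegral_add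
    ((continuous_const.fun_mul hW.continuous).fun_add
      (contDiff_euler (b := 0) hW (by norm_num)).continuous) ((cL hf hg).fun_sub (cL hg hf))]
  refine angularIntegral_congr fun ω hω => ?_
  set x := x₀ + r • ω with hx
  have hr : ‖x - x₀‖ ^ 2 = r ^ 2 := by simp [hx, norm_smul, hω]
  -- The products of first derivatives cancel.
  have hsub : euler x₀ (fun x => f x * euler x₀ g x - g x * euler x₀ f x) x =
      f x * euler x₀ (euler x₀ g) x - g x * euler x₀ (euler x₀ f) x := by
    have e : (fun x => f x * euler x₀ g x - g x * euler x₀ f x) =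
        fun x => f x * euler x₀ g x + (-1) * (g x * euler x₀ f x) := by funext; ring
    rw [e, euler_add ((d hf1).fun_mul (d eg)) (((d hg1).fun_mul (d ef)).const_mul _),
      euler_const_mul _ ((d hg1).fun_mul (d ef)), euler_mul (d hf1) (d eg), euler_mul (d hg1) (d ef)]
    ring
  rw [hsub, ← hr, sphLaplacian, sphLaplacian]
  ring

/-- Substitute `D - k` for the Euler operator in the polar form `r²Δ = (r∂_r)² + (n - 2) r∂_r + L`.
-/
theorem norm_sq_mul_laplacian (k : ℝ) {f : E n → ℝ} (hf : ContDiff ℝ 2 f) (x : E n) :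
    ‖x - x₀‖ ^ 2 * Δ f x = (scaleDeriv k x₀ (scaleDeriv k x₀ f) x
      + ((n : ℝ) - 2 - 2 * k) * scaleDeriv k x₀ f x)
      + (k * (k - ((n : ℝ) - 2)) * f x + sphLaplacian x₀ f x) := by
  have h1 : Differentiable ℝ f := hf.differentiable (by norm_num)
  have h2 : Differentiable ℝ (euler x₀ f) :=
    (contDiff_euler (b := 1) hf (by norm_num)).differentiable (by norm_num)
  have h3 : scaleDeriv k x₀ (scaleDeriv k x₀ f) x =
      k * scaleDeriv k x₀ f x + (k * euler x₀ f x + euler x₀ (euler x₀ f) x) := by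
    conv_lhs => rw [scaleDeriv]
    congr 1
    unfold scaleDeriv
    rw [euler_add (h1.const_mul k) h2, euler_const_mul k h1]
  rw [h3, sphLaplacian]
  unfold scaleDeriv
  ring

/-- The boundary term in Green's second identity for `Δ f` and `scaleDeriv k x₀ f`, in terms of
scaled pairings. -/
theorem angularIntegral_wronskian_laplacian (k : ℝ) {f w w₁ w₂ : E n → ℝ} (hf : ContDiff ℝ 4 f)
    (hw : w = scaleDeriv k x₀ f) (hw₁ : w₁ = scaleDeriv k x₀ w) (hw₂ : w₂ = scaleDeriv k x₀ w₁)
    {r : ℝ} :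
    r ^ 2 * (r ^ (2 * k) *
      angularIntegral x₀ (fun x => Δ f x * euler x₀ w x - w x * euler x₀ (Δ f) x) r) =
    (scaledPairing k x₀ w₁ w₁ r + ((n : ℝ) - 2 - 2 * k) * scaledPairing k x₀ w w₁ r +
      (k * (k - ((n : ℝ) - 2)) * scaledPairing k x₀ f w₁ r +
        scaledPairing k x₀ (sphLaplacian x₀ f) w₁ r))
    - (scaledPairing k x₀ w₂ w r + ((n : ℝ) - 2 - 2 * k) * scaledPairing k x₀ w₁ w r +
      (k * (k - ((n : ℝ) - 2)) * scaledPairing k x₀ w w r +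
        scaledPairing k x₀ (sphLaplacian x₀ w) w r))
    + 2 * (scaledPairing k x₀ w₁ w r + ((n : ℝ) - 2 - 2 * k) * scaledPairing k x₀ w w r +
      (k * (k - ((n : ℝ) - 2)) * scaledPairing k x₀ f w r +
        scaledPairing k x₀ (sphLaplacian x₀ f) w r)) := by
  set α : ℝ := (n : ℝ) - 2 - 2 * k with hα
  set β : ℝ := k * (k - ((n : ℝ) - 2)) with hβ
  have cw : ContDiff ℝ 3 w := hw ▸ contDiff_scaleDeriv hf (by norm_num)
  have cw₁ : ContDiff ℝ 2 w₁ := hw₁ ▸ contDiff_scaleDeriv cw (by norm_num)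
  have cw₂ : ContDiff ℝ 1 w₂ := hw₂ ▸ contDiff_scaleDeriv cw₁ (by norm_num)
  have cL : ContDiff ℝ 2 (sphLaplacian x₀ f) := contDiff_sphLaplacian hf (by norm_num)
  have cLw : ContDiff ℝ 1 (sphLaplacian x₀ w) := contDiff_sphLaplacian cw (by norm_num)
  have cΔ : ContDiff ℝ 2 (Δ f) := contDiff_laplacian hf (by norm_num)
  have d {m : WithTop ℕ∞} {a : E n → ℝ} (ha : ContDiff ℝ m a) (hm : 1 ≤ m) : Differentiable ℝ a :=
    (ha.of_le hm).differentiable (by norm_num)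
  have df := d hf (by norm_num)
  have dw := d cw (by norm_num)
  have dw₁ := d cw₁ (by norm_num)
  have dL := d cL (by norm_num)
  have dΔ := d cΔ (by norm_num)
  have dr : Differentiable ℝ fun x : E n => ‖x - x₀‖ ^ 2 :=
    (contDiff_norm_sub_sq (a := 1)).differentiable (by norm_num)
  have expand : ∀ a b c e h : E n → ℝ, Continuous a → Continuous b → Continuous c →
      Continuous e → Continuous h →
      scaledPairing k x₀ (fun x => (a x + α * b x) + (β * c x + e x)) h r =
      scaledPairing k x₀ a h r + α * scaledPairing k x₀ b h r +
        (β * scaledPairing k x₀ c h r + scaledPairing k x₀ e h r) := by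
    intro a b c e h ha hb hc he hh
    rw [scaledPairing_add_left (ha.fun_add (continuous_const.fun_mul hb))
      ((continuous_const.fun_mul hc).fun_add he) hh,
      scaledPairing_add_left ha (continuous_const.fun_mul hb) hh,
      scaledPairing_add_left (continuous_const.fun_mul hc) he hh,
      scaledPairing_const_mul_left, scaledPairing_const_mul_left]
  have hH : (fun x => ‖x - x₀‖ ^ 2 * Δ f x) =
      fun x => (w₁ x + α * w x) + (β * f x + sphLaplacian x₀ f x) := by
    funext x
    rw [norm_sq_mul_laplacian k (hf.of_le (by norm_num)), hw₁, hw]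
  -- `D` shifts `f, w, w₁` to `w, w₁, w₂` and passes through the spherical Laplacian.
  have hDH : scaleDeriv k x₀ (fun x => ‖x - x₀‖ ^ 2 * Δ f x) =
      fun x => (w₂ x + α * w₁ x) + (β * w x + sphLaplacian x₀ w x) := by
    funext x
    rw [hH, scaleDeriv_add (dw₁.fun_add (dw.const_mul _)) ((df.const_mul _).fun_add dL),
      scaleDeriv_add dw₁ (dw.const_mul _), scaleDeriv_add (df.const_mul _) dL,
      scaleDeriv_const_mul _ dw, scaleDeriv_const_mul _ df, ← hw₁, ← hw₂, ← hw, hw,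
      sphLaplacian_scaleDeriv (hf.of_le (by norm_num))]
  have cH := ((cw₁.continuous.fun_add (continuous_const.fun_mul cw.continuous)).fun_add
    ((continuous_const.fun_mul hf.continuous).fun_add cL.continuous) :
      Continuous fun x => (w₁ x + α * w x) + (β * f x + sphLaplacian x₀ f x))
  have cDH := ((cw₂.continuous.fun_add (continuous_const.fun_mul cw₁.continuous)).fun_add
    ((continuous_const.fun_mul cw.continuous).fun_add cLw.continuous) :
      Continuous fun x => (w₂ x + α * w₁ x) + (β * w x + sphLaplacian x₀ w x))
  rw [← expand w₁ w f _ w₁ cw₁.continuous cw.continuous hf.continuous cL.continuous cw₁.continuous,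
    ← expand w₂ w₁ w _ w cw₂.continuous cw₁.continuous cw.continuous cLw.continuous cw.continuous,
    ← expand w₁ w f _ w cw₁.continuous cw.continuous hf.continuous cL.continuous cw.continuous]
  unfold scaledPairing
  -- With `H = |x - x₀|²Δf`, the integrand times `r²` is `H Dw - w DH + 2Hw`: the multiples of `k`
  -- cancel, and `2Hw` comes from differentiating `|x - x₀|²`.
  have hpoint : r ^ 2 * angularIntegral x₀ (fun x => Δ f x * euler x₀ w x
      - w x * euler x₀ (Δ f) x) r =
      angularIntegral x₀ (fun x => ((w₁ x + α * w x) + (β * f x + sphLaplacian x₀ f x)) * w₁ x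
        - ((w₂ x + α * w₁ x) + (β * w x + sphLaplacian x₀ w x)) * w x
        + 2 * (((w₁ x + α * w x) + (β * f x + sphLaplacian x₀ f x)) * w x)) r := by
    rw [← angularIntegral_const_mul]
    refine angularIntegral_congr fun ω hω => ?_
    set x := x₀ + r • ω with hx
    have hr : ‖x - x₀‖ ^ 2 = r ^ 2 := by simp [hx, norm_smul, hω]
    have e1 := congrFun hH x
    have e2 := congrFun hDH x
    have e3 : w₁ x = k * w x + euler x₀ w x := by rw [hw₁, scaleDeriv]
    rw [scaleDeriv, euler_mul dr dΔ, euler_norm_sub_sq] at e2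
    rw [← e1, ← e2, e3, hr]
    ring
  rw [angularIntegral_add ((cH.fun_mul cw₁.continuous).fun_sub (cDH.fun_mul cw.continuous))
    (continuous_const.fun_mul (cH.fun_mul cw.continuous)),
    angularIntegral_sub (cH.fun_mul cw₁.continuous) (cDH.fun_mul cw.continuous),
    angularIntegral_const_mul] at hpoint
  linear_combination r ^ (2 * k) * hpoint

end Scaling

/-! ### The Pohozaev identity -/

section Pohozaev

variable {n m : ℕ} {x₀ : E n} {p : ℝ} {u : E n → E m}

theorem contDiff_comp {a : WithTop ℕ∞} (hu : ContDiff ℝ a u) (i : Fin m) :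
    ContDiff ℝ a (comp u i) :=
  contDiff_euclidean.1 hu i

theorem norm_sq_eq_sum_comp (x : E n) : ‖u x‖ ^ 2 = ∑ i, comp u i x * comp u i x := by
  rw [EuclideanSpace.norm_sq_eq]
  simp [comp, sq]

theorem euler_comp (hu : Differentiable ℝ u) (i : Fin m) (x : E n) :
    euler x₀ (comp u i) x = fderiv ℝ u x (x - x₀) i := by
  have h : HasFDerivAt (comp u i)
      ((EuclideanSpace.proj i : E m →L[ℝ] ℝ).comp (fderiv ℝ u x)) x :=
    (EuclideanSpace.proj i : E m →L[ℝ] ℝ).hasFDerivAt.comp x (hu x).hasFDerivAt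
  rw [euler, h.fderiv]
  rfl

/-- Since `p + 1 > 1`, the power is differentiable at the zeros of `u` as well. -/
theorem euler_norm_rpow (hp : 0 < p) (hu : Differentiable ℝ u) (x : E n) :
    euler x₀ (fun x => ‖u x‖ ^ (p + 1)) x =
      (p + 1) * ∑ i, ‖u x‖ ^ (p - 1) * comp u i x * euler x₀ (comp u i) x := by
  rw [euler, hu.fderiv_norm_rpow (by linarith)]
  simp only [_root_.smul_apply, ContinuousLinearMap.comp_apply, innerSL_apply_apply, smul_eq_mul,
    euler_comp hu, PiLp.inner_apply, Finset.mul_sum]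
  refine Finset.sum_congr rfl fun i _ => ?_
  have : p + 1 - 2 = p - 1 := by ring
  simp only [this, comp, RCLike.inner_apply, conj_trivial]
  ring

/-- The density `½ ∑ |Δ u_i|² - |u|^(p+1) / (p+1)`. -/
def energyDensity (p : ℝ) (u : E n → E m) (x : E n) : ℝ :=
  (1 / 2) * ∑ i, (Δ (comp u i) x) ^ 2 - 1 / (p + 1) * ‖u x‖ ^ (p + 1)

theorem contDiff_energyDensity (hp : 0 < p) (hu : ContDiff ℝ 4 u) :
    ContDiff ℝ 1 (energyDensity p u) := by
  have h : ∀ i, ContDiff ℝ 1 (Δ (comp u i)) := fun i =>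
    contDiff_laplacian (contDiff_comp (hu.of_le (m := 3) (by norm_num)) i) (by norm_num)
  exact (contDiff_const.mul (ContDiff.sum fun i _ => (h i).pow 2)).sub
    (contDiff_const.mul ((hu.of_le (by norm_num)).norm_rpow (by linarith)))

/-- Infinitesimal form of Noether's identity: both parts of the density have weight `4 + 2k` under
the scaling, and the equation replaces the potential's variation by `Δ²u`. -/
theorem euler_energyDensity {k : ℝ} (hp : 1 < p) (hk : k * (p - 1) = 4)
    (hu : IsClassicalSolution p u) (x : E n) :
    (4 + 2 * k) * energyDensity p u x + euler x₀ (energyDensity p u) x =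
      ∑ i, (Δ (comp u i) x * Δ (scaleDeriv k x₀ (comp u i)) x
        - scaleDeriv k x₀ (comp u i) x * Δ (Δ (comp u i)) x) := by
  have hc : ∀ i, ContDiff ℝ 3 (comp u i) := fun i =>
    contDiff_comp (hu.contDiff.of_le (by norm_num)) i
  have hd : ∀ i, Differentiable ℝ (Δ (comp u i)) := fun i =>
    (contDiff_laplacian (b := 1) (hc i) (by norm_num)).differentiable (by norm_num)
  have hud : Differentiable ℝ u := hu.contDiff.differentiable (by norm_num)
  have hpow : Differentiable ℝ fun x => ‖u x‖ ^ (p + 1) := hud.norm_rpow (by linarith)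
  have h : energyDensity p u = fun x => (1 / 2) * (∑ i, Δ (comp u i) x * Δ (comp u i) x)
      + (-(1 / (p + 1))) * ‖u x‖ ^ (p + 1) := by
    funext x; simp only [energyDensity, sq]; ring
  have hsum : Differentiable ℝ fun x => ∑ i, Δ (comp u i) x * Δ (comp u i) x :=
    Differentiable.fun_sum fun i _ => (hd i).fun_mul (hd i)
  have hpp : ‖u x‖ ^ (p + 1) = ∑ i, ‖u x‖ ^ (p - 1) * comp u i x * comp u i x := by
    have : p + 1 = (p - 1) + (2 : ℕ) := by push_cast; ring
    rw [this, Real.rpow_add_natCast' (norm_nonneg _) (by push_cast; linarith),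
      norm_sq_eq_sum_comp, Finset.mul_sum]
    simp only [mul_assoc]
  rw [h, euler_add (hsum.const_mul _) (hpow.const_mul _), euler_const_mul _ hsum,
    euler_const_mul _ hpow, euler_sum fun i _ => (hd i).fun_mul (hd i),
    euler_norm_rpow (by linarith) hud]
  have hR : ∀ i, Δ (comp u i) x * Δ (scaleDeriv k x₀ (comp u i)) x
        - scaleDeriv k x₀ (comp u i) x * Δ (Δ (comp u i)) x =
      (k + 2) * (Δ (comp u i) x * Δ (comp u i) x)
      + (1 / 2) * (euler x₀ (fun x => Δ (comp u i) x * Δ (comp u i) x) x)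
      - k * (‖u x‖ ^ (p - 1) * comp u i x * comp u i x)
      - ‖u x‖ ^ (p - 1) * comp u i x * euler x₀ (comp u i) x := by
    intro i
    rw [laplacian_scaleDeriv (hc i), hu.eqn, euler_mul (hd i) (hd i), scaleDeriv]
    ring
  simp only [hR, Finset.sum_add_distrib, Finset.sum_sub_distrib, ← Finset.mul_sum, ← hpp]
  -- The relation `k(p - 1) = 4` is the same as `4 + 2k = k(p + 1)`, so the potential has the weight
  -- of the bilaplacian term.
  have hk' : (4 + 2 * k) / (p + 1) = k := by
    rw [div_eq_iff (by linarith)]; linarith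
  have hp1 : 1 / (p + 1) * (p + 1) = 1 := by rw [one_div, inv_mul_cancel₀ (by linarith)]
  linear_combination (-‖u x‖ ^ (p + 1)) * hk' -
    (∑ i, ‖u x‖ ^ (p - 1) * comp u i x * euler x₀ (comp u i) x) * hp1

/-- The boundary term in Green's second identity for `Δ u_i` and `scaleDeriv k x₀ u_i`. -/
def boundaryDensity (k : ℝ) (x₀ : E n) (u : E n → E m) (x : E n) : ℝ :=
  ∑ i, (Δ (comp u i) x * euler x₀ (scaleDeriv k x₀ (comp u i)) x
    - scaleDeriv k x₀ (comp u i) x * euler x₀ (Δ (comp u i)) x)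

theorem contDiff_boundarySummand {k : ℝ} {f : E n → ℝ} (hf : ContDiff ℝ 4 f) :
    ContDiff ℝ 1 fun x => Δ f x * euler x₀ (scaleDeriv k x₀ f) x
      - scaleDeriv k x₀ f x * euler x₀ (Δ f) x := by
  have h1 : ContDiff ℝ 2 (Δ f) := contDiff_laplacian hf (by norm_num)
  have h2 : ContDiff ℝ 3 (scaleDeriv k x₀ f) := contDiff_scaleDeriv hf (by norm_num)
  exact ((h1.of_le (by norm_num)).mul ((contDiff_euler h2 (b := 2) (by norm_num)).of_le
    (by norm_num))).sub ((h2.of_le (by norm_num)).mul (contDiff_euler h1 (by norm_num)))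

/-- The Pohozaev identity on balls. -/
theorem pohozaev_identity {k : ℝ} (hn : 3 ≤ n) (hp : 1 < p) (hk : k * (p - 1) = 4)
    (hu : IsClassicalSolution p u) {ρ : ℝ} (hρ : 0 < ρ) :
    (4 + 2 * k - n) * (∫ x in ball x₀ ρ, energyDensity p u x)
      + ρ ^ n * angularIntegral x₀ (energyDensity p u) ρ =
    ρ ^ (n - 2) * angularIntegral x₀ (boundaryDensity k x₀ u) ρ := by
  set F := energyDensity p u with hF
  set B := boundaryDensity k x₀ u with hB
  have hc : ∀ i, ContDiff ℝ 4 (comp u i) := contDiff_comp hu.contDiff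
  have cF : ContDiff ℝ 1 F := contDiff_energyDensity (by linarith) hu.contDiff
  have cB : ContDiff ℝ 1 B := ContDiff.sum fun i _ => contDiff_boundarySummand (hc i)
  obtain ⟨N, rfl⟩ : ∃ N, n = N + 3 := ⟨n - 3, by omega⟩
  -- `K` is the difference of the two sides as a function of the radius; it is continuous down to
  -- `0` and has zero derivative for positive radii.
  let K : ℝ → ℝ := fun s => (4 + 2 * k - (N + 3 : ℕ)) *
    (∫ r in (0 : ℝ)..s, r ^ (N + 2) * angularIntegral x₀ F r)
    + s ^ (N + 3) * angularIntegral x₀ F s - s ^ (N + 1) * angularIntegral x₀ B s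
  have cint : Continuous fun r : ℝ => r ^ (N + 2) * angularIntegral x₀ F r :=
    (continuous_pow _).mul (continuous_angularIntegral cF.continuous)
  have hKc : Continuous K :=
    ((continuous_const.mul (intervalIntegral.continuous_primitive
      (fun a b => cint.intervalIntegrable a b) 0)).add ((continuous_pow _).mul
      (continuous_angularIntegral cF.continuous))).sub
      ((continuous_pow _).mul (continuous_angularIntegral cB.continuous))
  have hKd : ∀ s : ℝ, 0 < s → HasDerivAt K 0 s := by
    intro s hs
    have h1 := (intervalIntegral.integral_hasDerivAt_right (cint.intervalIntegrable 0 s)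
      (cint.stronglyMeasurableAtFilter _ _) cint.continuousAt).const_mul
        (4 + 2 * k - (N + 3 : ℕ))
    have h2 := (hasDerivAt_pow (N + 3) s).fun_mul
      (hasDerivAt_angularIntegral (x₀ := x₀) cF hs.ne')
    have h3 := (hasDerivAt_pow (N + 1) s).fun_mul
      (hasDerivAt_angularIntegral (x₀ := x₀) cB hs.ne')
    refine ((h1.fun_add h2).fun_sub h3).congr_deriv ?_
    have hW : ∀ i, Continuous fun x => Δ (comp u i) x * Δ (scaleDeriv k x₀ (comp u i)) x
        - scaleDeriv k x₀ (comp u i) x * Δ (Δ (comp u i)) x := by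
      intro i
      have h1 : ContDiff ℝ 2 (Δ (comp u i)) := contDiff_laplacian (hc i) (by norm_num)
      have h2 : ContDiff ℝ 3 (scaleDeriv k x₀ (comp u i)) :=
        contDiff_scaleDeriv (hc i) (by norm_num)
      exact (h1.continuous.mul (contDiff_laplacian (b := 1) h2 (by norm_num)).continuous).sub
        (h2.continuous.mul (contDiff_laplacian (b := 0) h1 (by norm_num)).continuous)
    have hFint : (4 + 2 * k) * angularIntegral x₀ F s + angularIntegral x₀ (euler x₀ F) s =
        ∑ i, angularIntegral x₀ (fun x => Δ (comp u i) x * Δ (scaleDeriv k x₀ (comp u i)) x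
          - scaleDeriv k x₀ (comp u i) x * Δ (Δ (comp u i)) x) s := by
      rw [← angularIntegral_const_mul, ← angularIntegral_add
        (continuous_const.fun_mul cF.continuous)
        (contDiff_euler (b := 0) cF (by norm_num)).continuous,
        ← angularIntegral_sum fun i _ => hW i]
      exact congrFun (congrArg _ (funext (euler_energyDensity hp hk hu))) s
    -- The factor `N + 1 = n - 2` is that of `angularIntegral_euler_wronskian`, applied to `Δ u_i`
    -- and `D u_i`.
    have hBint : ((N : ℝ) + 1) * angularIntegral x₀ B s + angularIntegral x₀ (euler x₀ B) s =
        s ^ 2 * ∑ i, angularIntegral x₀ (fun x => Δ (comp u i) x * Δ (scaleDeriv k x₀ (comp u i)) x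
          - scaleDeriv k x₀ (comp u i) x * Δ (Δ (comp u i)) x) s := by
      have hd : ∀ i ∈ Finset.univ, Differentiable ℝ fun x =>
          Δ (comp u i) x * euler x₀ (scaleDeriv k x₀ (comp u i)) x
            - scaleDeriv k x₀ (comp u i) x * euler x₀ (Δ (comp u i)) x := fun i _ =>
        (contDiff_boundarySummand (hc i)).differentiable (by norm_num)
      have e1 : euler x₀ B = fun x => ∑ i, euler x₀ (fun x =>
          Δ (comp u i) x * euler x₀ (scaleDeriv k x₀ (comp u i)) x
            - scaleDeriv k x₀ (comp u i) x * euler x₀ (Δ (comp u i)) x) x :=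
        funext (euler_sum hd)
      rw [e1, angularIntegral_sum fun i _ =>
          (contDiff_euler (b := 0) (contDiff_boundarySummand (hc i)) (by norm_num)).continuous,
        hB, show boundaryDensity k x₀ u = fun x => ∑ i, _ from rfl,
        angularIntegral_sum fun i _ => (contDiff_boundarySummand (hc i)).continuous,
        Finset.mul_sum, Finset.mul_sum, ← Finset.sum_add_distrib]
      refine Finset.sum_congr rfl fun i _ => ?_
      rw [← angularIntegral_euler_wronskian (contDiff_laplacian (hc i) (by norm_num))
        (contDiff_scaleDeriv (hc i) (by norm_num))]
      push_cast
      ring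
    rw [← hFint] at hBint
    simp only [Nat.add_sub_cancel, show N + 3 - 1 = N + 2 from rfl]
    push_cast
    have hs' := hs.ne'
    have e : s⁻¹ * s = 1 := inv_mul_cancel₀ hs'
    linear_combination (-s ^ N) * hBint +
      (s ^ (N + 2) * angularIntegral x₀ (euler x₀ F) s
        - s ^ N * angularIntegral x₀ (euler x₀ B) s) * e
  -- The boundary terms vanish at radius zero because `n - 2 = N + 1` is positive.
  have hK0 : K 0 = 0 := by simp [K]
  have hKρ : K ρ = 0 := by
    obtain ⟨c, hc, h⟩ := exists_hasDerivAt_eq_slope K (fun _ => 0) hρ hKc.continuousOn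
      fun s hs => hKd s hs.1
    rw [hK0, sub_zero, sub_zero, eq_comm, div_eq_zero_iff] at h
    exact h.resolve_right hρ.ne'
  rw [integral_ball_eq (by omega) cF.continuous hρ.le]
  exact sub_eq_zero.1 hKρ

/-- The derivative of the scaled energy on balls is a boundary term. -/
theorem hasDerivAt_scaled_integral_ball {k : ℝ} (hn : 3 ≤ n) (hp : 1 < p) (hk : k * (p - 1) = 4)
    (hu : IsClassicalSolution p u) {ρ : ℝ} (hρ : 0 < ρ) :
    HasDerivAt (fun ρ => ρ ^ (4 + 2 * k - n) * ∫ x in ball x₀ ρ, energyDensity p u x)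
      (ρ * (ρ ^ (2 * k) * angularIntegral x₀ (boundaryDensity k x₀ u) ρ)) ρ := by
  have cF : Continuous (energyDensity p u) :=
    (contDiff_energyDensity (by linarith) hu.contDiff).continuous
  have h := (Real.hasDerivAt_rpow_const (p := 4 + 2 * k - n) (Or.inl hρ.ne')).fun_mul
    (hasDerivAt_integral_ball (x₀ := x₀) (by omega) cF hρ)
  refine h.congr_deriv ?_
  -- The product rule gives `ρ^(3+2k-n)` times the left side of the Pohozaev identity, so the ball
  -- integral drops out.
  have key := pohozaev_identity (x₀ := x₀) hn hp hk hu hρ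
  obtain ⟨N, rfl⟩ : ∃ N, n = N + 3 := ⟨n - 3, by omega⟩
  have e1 : ρ ^ (4 + 2 * k - (N + 3 : ℕ)) * ρ ^ (N + 1) = ρ ^ (2 * k) * ρ ^ 2 := by
    rw [← Real.rpow_natCast, ← Real.rpow_natCast, ← Real.rpow_add hρ, ← Real.rpow_add hρ]
    congr 1
    push_cast
    ring
  simp only [show N + 3 - 2 = N + 1 from rfl] at key
  rw [Real.rpow_sub_one hρ.ne']
  simp only [show N + 3 - 1 = N + 2 from rfl]
  field_simp
  linear_combination ρ ^ (4 + 2 * k - (N + 3 : ℕ)) * key +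
    angularIntegral x₀ (boundaryDensity k x₀ u) ρ * e1

end Pohozaev

/-! ### The energy and its derivative in terms of pairings -/

section Energy

variable {n m : ℕ} {x₀ : E n} {p k : ℝ} {u : E n → E m}

/-- The sum of the scaled pairings of the components of two maps. -/
def pairingSum (k : ℝ) (x₀ : E n) (f g : Fin m → E n → ℝ) (r : ℝ) : ℝ :=
  ∑ i, scaledPairing k x₀ (f i) (g i) r

theorem pairingSum_comm (f g : Fin m → E n → ℝ) (r : ℝ) :
    pairingSum k x₀ f g r = pairingSum k x₀ g f r :=
  Finset.sum_congr rfl fun _ _ => scaledPairing_comm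

theorem pairingSum_self_nonneg (f : Fin m → E n → ℝ) {r : ℝ} (hr : 0 ≤ r) :
    0 ≤ pairingSum k x₀ f f r :=
  Finset.sum_nonneg fun _ _ => scaledPairing_self_nonneg hr

theorem hasDerivAt_pairingSum {f g : Fin m → E n → ℝ} (hf : ∀ i, ContDiff ℝ 1 (f i))
    (hg : ∀ i, ContDiff ℝ 1 (g i)) {r : ℝ} (hr : 0 < r) :
    HasDerivAt (pairingSum k x₀ f g) (r⁻¹ * (pairingSum k x₀ (fun i => scaleDeriv k x₀ (f i)) g r
      + pairingSum k x₀ f (fun i => scaleDeriv k x₀ (g i)) r)) r := by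
  have h := HasDerivAt.fun_sum (u := Finset.univ) fun i _ =>
    hasDerivAt_scaledPairing (k := k) (x₀ := x₀) (hf i) (hg i) hr
  refine h.congr_deriv ?_
  simp only [pairingSum, ← Finset.sum_add_distrib, Finset.mul_sum]

theorem radialDeriv_eq (f : E n → ℝ) (x : E n) :
    radialDeriv x₀ f x = ‖x - x₀‖⁻¹ * euler x₀ f x := by
  rw [radialDeriv, map_smul, smul_eq_mul, euler]

theorem norm_gradient_sq {f : E n → ℝ} (x : E n) :
    ‖gradient f x‖ ^ 2 = ∑ i, pderiv i f x * pderiv i f x := by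
  rw [EuclideanSpace.norm_sq_eq]
  refine Finset.sum_congr rfl fun i _ => ?_
  have h : gradient f x i = pderiv i f x := by
    have := InnerProductSpace.toDual_symm_apply (𝕜 := ℝ) (x := EuclideanSpace.single i (1 : ℝ))
      (y := fderiv ℝ f x)
    rw [EuclideanSpace.inner_single_right] at this
    simpa [gradient, pderiv] using this
  rw [h, Real.norm_eq_abs, sq_abs, sq]

theorem norm_slice {ρ : ℝ} (hρ : 0 < ρ) {ω : E n} (hω : ‖ω‖ = 1) : ‖x₀ + ρ • ω - x₀‖ = ρ := by
  simp [norm_smul, hω, abs_of_pos hρ]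

theorem homogeneityDefect_eq (hk : 4 / (p - 1) = k) (x : E n) :
    homogeneityDefect p u x₀ x = ∑ i, (k * ‖x - x₀‖⁻¹ * comp u i x
      + ‖x - x₀‖⁻¹ * euler x₀ (comp u i) x) ^ 2 := by
  simp only [homogeneityDefect, hk, radialDeriv_eq]

/-- The defect of homogeneity `k r⁻¹u_i + ∂_r u_i` equals `r⁻¹ D u_i`. -/
theorem angularIntegral_homogeneityDefect (hk : 4 / (p - 1) = k) (hu : ContDiff ℝ 1 u) {ρ : ℝ}
    (hρ : 0 < ρ) : ρ ^ (2 * k) * angularIntegral x₀ (homogeneityDefect p u x₀) ρ =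
      (ρ ^ 2)⁻¹ * pairingSum k x₀ (fun i => scaleDeriv k x₀ (comp u i))
        (fun i => scaleDeriv k x₀ (comp u i)) ρ := by
  have hc : ∀ i, Continuous (scaleDeriv k x₀ (comp u i)) := fun i =>
    (contDiff_scaleDeriv (b := 0) (contDiff_comp hu i) (by norm_num)).continuous
  simp only [pairingSum, scaledPairing, ← Finset.mul_sum]
  rw [← angularIntegral_sum fun i _ => (hc i).fun_mul (hc i), mul_left_comm,
    ← angularIntegral_const_mul _ (ρ ^ 2)⁻¹]
  congr 1
  refine angularIntegral_congr fun ω hω => ?_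
  rw [homogeneityDefect_eq hk, norm_slice hρ hω, Finset.mul_sum]
  refine Finset.sum_congr rfl fun i _ => ?_
  rw [scaleDeriv, ← inv_pow]
  ring

/-- The squared tangential gradient is `r⁻²Γ(u_i, u_i)`; Green's formula on the sphere turns it into
`-r⁻² u_i L u_i`. -/
theorem angularIntegral_tangentialDensity (hu : ContDiff ℝ 2 u) {ρ : ℝ} (hρ : 0 < ρ) :
    ρ ^ (2 * k) * angularIntegral x₀ (tangentialDensity u x₀) ρ =
      -((ρ ^ 2)⁻¹ * pairingSum k x₀ (comp u) (fun i => sphLaplacian x₀ (comp u i)) ρ) := by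
  have hc : ∀ i, ContDiff ℝ 2 (comp u i) := contDiff_comp hu
  have hc1 : ∀ i, ContDiff ℝ 1 (comp u i) := fun i => (hc i).of_le (by norm_num)
  simp only [pairingSum, scaledPairing_sphLaplacian (hc _), Finset.sum_neg_distrib,
    ← Finset.mul_sum]
  rw [← angularIntegral_sum fun i _ => continuous_sphGamma (hc1 i) (hc1 i), mul_neg, neg_neg,
    mul_left_comm, ← angularIntegral_const_mul _ (ρ ^ 2)⁻¹]
  congr 1
  refine angularIntegral_congr fun ω hω => ?_
  rw [tangentialDensity, Finset.mul_sum]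
  refine Finset.sum_congr rfl fun i _ => ?_
  rw [radialDeriv_eq, norm_gradient_sq, sphGamma, norm_slice hρ hω]
  field_simp

theorem angularIntegral_norm_sq (hu : Continuous u) (ρ : ℝ) :
    ρ ^ (2 * k) * angularIntegral x₀ (fun x => ‖u x‖ ^ 2) ρ =
      pairingSum k x₀ (comp u) (comp u) ρ := by
  have hc : ∀ i, Continuous (comp u i) := fun i =>
    (contDiff_comp (contDiff_zero.2 hu) i).continuous
  simp only [pairingSum, scaledPairing, ← Finset.mul_sum]
  rw [← angularIntegral_sum fun i _ => (hc i).fun_mul (hc i)]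
  simp only [norm_sq_eq_sum_comp]

/-- Comparison of the weights of surface integrals and of angular integrals. -/
theorem rpow_mul_sphereIntegral (hn : 0 < n) {ρ : ℝ} (hρ : 0 < ρ) (a : ℝ) (f : E n → ℝ) :
    ρ ^ (a - n) * sphereIntegral x₀ ρ f = ρ ^ (a - 1) * angularIntegral x₀ f ρ := by
  rw [sphereIntegral_eq, ← mul_assoc, ← Real.rpow_natCast, ← Real.rpow_add hρ, Nat.cast_pred hn]
  congr 2
  ring

theorem massTerm_eq (hn : 0 < n) (hk : 4 / (p - 1) = k) {ρ : ℝ} (hρ : 0 < ρ)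
    (hu : Continuous u) :
    massTerm p u x₀ ρ = ρ * pairingSum k x₀ (comp u) (comp u) ρ := by
  have h8 : 8 / (p - 1) = 2 * k := by rw [← hk]; ring
  rw [massTerm, rpow_mul_sphereIntegral hn hρ, ← angularIntegral_norm_sq hu, h8,
    show 2 * k + 2 - 1 = 2 * k + 1 by ring, Real.rpow_add_one hρ.ne']
  ring

theorem defectTerm_eq (hn : 0 < n) (hk : 4 / (p - 1) = k) {ρ : ℝ} (hρ : 0 < ρ)
    (hu : ContDiff ℝ 1 u) :
    defectTerm p u x₀ ρ = (ρ ^ 2)⁻¹ * pairingSum k x₀ (fun i => scaleDeriv k x₀ (comp u i))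
        (fun i => scaleDeriv k x₀ (comp u i)) ρ := by
  have h8 : 8 / (p - 1) = 2 * k := by rw [← hk]; ring
  rw [defectTerm, rpow_mul_sphereIntegral hn hρ, h8, add_sub_cancel_right,
    angularIntegral_homogeneityDefect hk hu hρ]

theorem tangentialTerm_eq (hn : 0 < n) (hk : 4 / (p - 1) = k) {ρ : ℝ} (hρ : 0 < ρ)
    (hp : 1 < p) (hu : ContDiff ℝ 2 u) :
    tangentialTerm p u x₀ ρ =
      -(ρ * pairingSum k x₀ (comp u) (fun i => sphLaplacian x₀ (comp u i)) ρ) := by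
  have h4 : 4 * ((p + 1) / (p - 1)) = 2 * k + 4 := by
    have : p - 1 ≠ 0 := by linarith
    rw [← hk]; field_simp; ring
  rw [tangentialTerm, rpow_mul_sphereIntegral hn hρ, h4,
    show 2 * k + 4 - 1 = 2 * k + (3 : ℕ) by push_cast; ring, Real.rpow_add_natCast hρ.ne',
    mul_right_comm, angularIntegral_tangentialDensity hu hρ]
  field_simp

theorem hasDerivAt_massTerm (hn : 0 < n) (hk : 4 / (p - 1) = k) {ρ : ℝ} (hρ : 0 < ρ)
    (hu : ContDiff ℝ 1 u) :
    HasDerivAt (massTerm p u x₀) (pairingSum k x₀ (comp u) (comp u) ρ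
      + 2 * pairingSum k x₀ (comp u) (fun i => scaleDeriv k x₀ (comp u i)) ρ) ρ := by
  have h := (hasDerivAt_id ρ).fun_mul (hasDerivAt_pairingSum (k := k) (x₀ := x₀)
    (contDiff_comp hu) (contDiff_comp hu) hρ)
  refine (h.congr_of_eventuallyEq ?_).congr_deriv ?_
  · filter_upwards [lt_mem_nhds hρ] with s hs
    exact massTerm_eq hn hk hs hu.continuous
  · rw [pairingSum_comm (fun i => scaleDeriv k x₀ (comp u i))]
    simp only [id]
    field_simp
    ring

theorem hasDerivAt_defectTerm (hn : 0 < n) (hk : 4 / (p - 1) = k) {ρ : ℝ} (hρ : 0 < ρ)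
    (hu : ContDiff ℝ 2 u) :
    HasDerivAt (defectTerm p u x₀) ((ρ ^ 3)⁻¹ *
      (2 * pairingSum k x₀ (fun i => scaleDeriv k x₀ (comp u i))
        (fun i => scaleDeriv k x₀ (scaleDeriv k x₀ (comp u i))) ρ
      - 2 * pairingSum k x₀ (fun i => scaleDeriv k x₀ (comp u i))
        (fun i => scaleDeriv k x₀ (comp u i)) ρ)) ρ := by
  have hw : ∀ i, ContDiff ℝ 1 (scaleDeriv k x₀ (comp u i)) := fun i =>
    contDiff_scaleDeriv (contDiff_comp hu i) (by norm_num)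
  have h := ((hasDerivAt_pow 2 ρ).fun_inv (pow_ne_zero 2 hρ.ne')).fun_mul
    (hasDerivAt_pairingSum (k := k) (x₀ := x₀) hw hw hρ)
  refine (h.congr_of_eventuallyEq ?_).congr_deriv ?_
  · filter_upwards [lt_mem_nhds hρ] with s hs
    exact defectTerm_eq hn hk hs (hu.of_le (by norm_num))
  · rw [pairingSum_comm (fun i => scaleDeriv k x₀ (scaleDeriv k x₀ (comp u i)))]
    field_simp
    ring

theorem hasDerivAt_tangentialTerm (hn : 0 < n) (hk : 4 / (p - 1) = k) {ρ : ℝ} (hρ : 0 < ρ)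
    (hp : 1 < p) (hu : ContDiff ℝ 3 u) :
    HasDerivAt (tangentialTerm p u x₀)
      (-(pairingSum k x₀ (comp u) (fun i => sphLaplacian x₀ (comp u i)) ρ
        + 2 * pairingSum k x₀ (fun i => scaleDeriv k x₀ (comp u i))
          (fun i => sphLaplacian x₀ (comp u i)) ρ)) ρ := by
  have hc : ∀ i, ContDiff ℝ 3 (comp u i) := contDiff_comp hu
  have h := ((hasDerivAt_id ρ).fun_mul (hasDerivAt_pairingSum (k := k) (x₀ := x₀)
    (fun i => (hc i).of_le (by norm_num))
    (fun i => contDiff_sphLaplacian (x₀ := x₀) (hc i) (by norm_num)) hρ)).fun_neg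
  refine (h.congr_of_eventuallyEq ?_).congr_deriv ?_
  · filter_upwards [lt_mem_nhds hρ] with s hs
    exact tangentialTerm_eq hn hk hs hp (hu.of_le (by norm_num))
  -- Since `DL = LD` and `L` is symmetric, both terms of the product rule coincide.
  · have e : pairingSum k x₀ (comp u) (fun i => scaleDeriv k x₀ (sphLaplacian x₀ (comp u i))) ρ =
        pairingSum k x₀ (fun i => scaleDeriv k x₀ (comp u i))
          (fun i => sphLaplacian x₀ (comp u i)) ρ := by
      refine Finset.sum_congr rfl fun i _ => ?_
      beta_reduce
      rw [← funext (sphLaplacian_scaleDeriv (hc i)), scaledPairing_sphLaplacian_comm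
        ((hc i).of_le (by norm_num)) (contDiff_scaleDeriv (hc i) (by norm_num))]
    rw [e]
    simp only [id]
    field_simp
    ring

/-- The energy in terms of scaled pairings. -/
theorem energy₂_eq (hn : 0 < n) (hk : 4 / (p - 1) = k) {ρ : ℝ} (hρ : 0 < ρ)
    (hp : 1 < p) (hu : ContDiff ℝ 3 u) :
    energy₂ p u x₀ ρ = ρ ^ (4 + 2 * k - n) * (∫ x in ball x₀ ρ, energyDensity p u x)
      + (pairingSum k x₀ (fun i => scaleDeriv k x₀ (comp u i))
          (fun i => scaleDeriv k x₀ (scaleDeriv k x₀ (comp u i))) ρ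
        - pairingSum k x₀ (fun i => scaleDeriv k x₀ (comp u i))
          (fun i => scaleDeriv k x₀ (comp u i)) ρ
        - k * (k - ((n : ℝ) - 2)) *
          (pairingSum k x₀ (comp u) (fun i => scaleDeriv k x₀ (comp u i)) ρ
            + pairingSum k x₀ (comp u) (comp u) ρ)
        - pairingSum k x₀ (fun i => scaleDeriv k x₀ (comp u i))
          (fun i => sphLaplacian x₀ (comp u i)) ρ
        - pairingSum k x₀ (comp u) (fun i => sphLaplacian x₀ (comp u i)) ρ) := by
  have hp0 : p - 1 ≠ 0 := by linarith
  have h8 : 8 / (p - 1) = 2 * k := by rw [← hk]; ring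
  have h4 : 4 * ((p + 1) / (p - 1)) = 4 + 2 * k := by rw [← hk]; field_simp; ring
  -- Together with `h3` this identifies the coefficient of the two mass terms as `-k(k - (n -
  -- 2))/2`, that is `-β/2`.
  have h2 : 2 / (p - 1) = k / 2 := by rw [← hk]; ring
  have h3 : (p + 3) / (p - 1) = 1 + k := by rw [← hk]; field_simp; ring
  have hm : ρ ^ (1 + 8 / (p - 1) - n) * sphereIntegral x₀ ρ (fun x => ‖u x‖ ^ 2) =
      pairingSum k x₀ (comp u) (comp u) ρ := by
    rw [rpow_mul_sphereIntegral hn hρ, h8, add_sub_cancel_left,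
      angularIntegral_norm_sq hu.continuous]
  have ht : ρ ^ (4 * ((p + 1) / (p - 1)) - n - 1) * sphereIntegral x₀ ρ (tangentialDensity u x₀) =
      -pairingSum k x₀ (comp u) (fun i => sphLaplacian x₀ (comp u i)) ρ := by
    rw [sub_right_comm, rpow_mul_sphereIntegral hn hρ, h4,
      show 4 + 2 * k - 1 - 1 = 2 * k + (2 : ℕ) by push_cast; ring, Real.rpow_add_natCast hρ.ne',
      mul_right_comm, angularIntegral_tangentialDensity (hu.of_le (by norm_num)) hρ]
    field_simp
  rw [energy₂, (hasDerivAt_massTerm hn hk hρ (hu.of_le (by norm_num))).deriv,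
    (hasDerivAt_defectTerm hn hk hρ (hu.of_le (by norm_num))).deriv,
    (hasDerivAt_tangentialTerm hn hk hρ hp hu).deriv, hm, ht, h4, h2, h3]
  change _ * (∫ x in ball x₀ ρ, energyDensity p u x) - _ - _ + _ + _ + _ = _
  field_simp
  ring

/-- The correction terms of the energy cancel all indefinite pairings of the boundary term; the
three that survive have a sign once `2k < n - 4` and `k > 0`. -/
theorem hasDerivAt_energy₂ (hn3 : 3 ≤ n) (hk : 4 / (p - 1) = k) {ρ : ℝ} (hρ : 0 < ρ)
    (hp : 1 < p) (hu : IsClassicalSolution p u) :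
    HasDerivAt (energy₂ p u x₀) (ρ⁻¹ *
      (2 * pairingSum k x₀ (fun i => scaleDeriv k x₀ (scaleDeriv k x₀ (comp u i)))
          (fun i => scaleDeriv k x₀ (scaleDeriv k x₀ (comp u i))) ρ
        + 2 * ((n : ℝ) - 2 - 2 * k - k * (k - ((n : ℝ) - 2))) *
          pairingSum k x₀ (fun i => scaleDeriv k x₀ (comp u i))
            (fun i => scaleDeriv k x₀ (comp u i)) ρ
        - 2 * pairingSum k x₀ (fun i => scaleDeriv k x₀ (comp u i))
            (fun i => sphLaplacian x₀ (scaleDeriv k x₀ (comp u i))) ρ)) ρ := by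
  set U := comp u with hU
  set W : Fin m → E n → ℝ := fun i => scaleDeriv k x₀ (U i) with hW
  set W₁ : Fin m → E n → ℝ := fun i => scaleDeriv k x₀ (W i) with hW₁
  set W₂ : Fin m → E n → ℝ := fun i => scaleDeriv k x₀ (W₁ i) with hW₂
  set L : Fin m → E n → ℝ := fun i => sphLaplacian x₀ (U i) with hL
  set LW : Fin m → E n → ℝ := fun i => sphLaplacian x₀ (W i) with hLW
  have cU : ∀ i, ContDiff ℝ 4 (U i) := contDiff_comp hu.contDiff
  have cW : ∀ i, ContDiff ℝ 3 (W i) := fun i => contDiff_scaleDeriv (cU i) (by norm_num)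
  have cW₁ : ∀ i, ContDiff ℝ 2 (W₁ i) := fun i => contDiff_scaleDeriv (cW i) (by norm_num)
  have cL : ∀ i, ContDiff ℝ 2 (L i) := fun i => contDiff_sphLaplacian (cU i) (by norm_num)
  have cU' : ∀ i, ContDiff ℝ 1 (U i) := fun i => (cU i).of_le (by norm_num)
  have cW' : ∀ i, ContDiff ℝ 1 (W i) := fun i => (cW i).of_le (by norm_num)
  have cW₁' : ∀ i, ContDiff ℝ 1 (W₁ i) := fun i => (cW₁ i).of_le (by norm_num)
  have cL' : ∀ i, ContDiff ℝ 1 (L i) := fun i => (cL i).of_le (by norm_num)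
  have hDL : (fun i => scaleDeriv k x₀ (L i)) = LW := by
    funext i
    exact (funext (sphLaplacian_scaleDeriv ((cU i).of_le (by norm_num)))).symm
  -- Needed for the cancellation of the mixed terms in `L`.
  have hULW : pairingSum k x₀ U LW ρ = pairingSum k x₀ W L ρ :=
    Finset.sum_congr rfl fun i _ =>
      scaledPairing_sphLaplacian_comm ((cU i).of_le (by norm_num)) ((cW i).of_le (by norm_num))
  have hk4 : k * (p - 1) = 4 := by rw [← hk, div_mul_cancel₀]; linarith
  have hball := hasDerivAt_scaled_integral_ball (x₀ := x₀) hn3 hp hk4 hu hρ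
  have d1 := hasDerivAt_pairingSum (k := k) (x₀ := x₀) cW' cW₁' hρ
  have d2 := hasDerivAt_pairingSum (k := k) (x₀ := x₀) cW' cW' hρ
  have d3 := hasDerivAt_pairingSum (k := k) (x₀ := x₀) cU' cW' hρ
  have d4 := hasDerivAt_pairingSum (k := k) (x₀ := x₀) cU' cU' hρ
  have d5 := hasDerivAt_pairingSum (k := k) (x₀ := x₀) cW' cL' hρ
  have d6 := hasDerivAt_pairingSum (k := k) (x₀ := x₀) cU' cL' hρ
  rw [hDL] at d5 d6
  have hall := hball.fun_add ((((d1.fun_sub d2).fun_sub ((d3.fun_add d4).const_mul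
    (k * (k - ((n : ℝ) - 2))))).fun_sub d5).fun_sub d6)
  refine (hall.congr_of_eventuallyEq ?_).congr_deriv ?_
  · filter_upwards [lt_mem_nhds hρ] with s hs
    exact energy₂_eq (by omega) hk hs hp (hu.contDiff.of_le (by norm_num))
  have hB : ρ ^ 2 * (ρ ^ (2 * k) * angularIntegral x₀ (boundaryDensity k x₀ u) ρ) =
      (pairingSum k x₀ W₁ W₁ ρ + ((n : ℝ) - 2 - 2 * k) * pairingSum k x₀ W W₁ ρ +
        (k * (k - ((n : ℝ) - 2)) * pairingSum k x₀ U W₁ ρ + pairingSum k x₀ L W₁ ρ))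
      - (pairingSum k x₀ W₂ W ρ + ((n : ℝ) - 2 - 2 * k) * pairingSum k x₀ W₁ W ρ +
        (k * (k - ((n : ℝ) - 2)) * pairingSum k x₀ W W ρ + pairingSum k x₀ LW W ρ))
      + 2 * (pairingSum k x₀ W₁ W ρ + ((n : ℝ) - 2 - 2 * k) * pairingSum k x₀ W W ρ +
        (k * (k - ((n : ℝ) - 2)) * pairingSum k x₀ U W ρ + pairingSum k x₀ L W ρ)) := by
    rw [show boundaryDensity k x₀ u = fun x => ∑ i, _ from rfl,
      angularIntegral_sum fun i _ => (contDiff_boundarySummand (cU i)).continuous]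
    simp only [pairingSum, Finset.mul_sum, ← Finset.sum_add_distrib, ← Finset.sum_sub_distrib]
    refine Finset.sum_congr rfl fun i _ => ?_
    have h := angularIntegral_wronskian_laplacian (x₀ := x₀) k (r := ρ) (cU i)
      (rfl : W i = _) (rfl : W₁ i = _) (rfl : W₂ i = _)
    simp only [mul_add] at h ⊢
    exact h
  rw [pairingSum_comm L W₁, pairingSum_comm W₂ W, pairingSum_comm LW W, pairingSum_comm L W,
    pairingSum_comm W₁ W] at hB
  have e : ρ * (ρ ^ (2 * k) * angularIntegral x₀ (boundaryDensity k x₀ u) ρ) =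
      ρ⁻¹ * (ρ ^ 2 * (ρ ^ (2 * k) * angularIntegral x₀ (boundaryDensity k x₀ u) ρ)) := by
    field_simp
  rw [e, hB, pairingSum_comm W₁ W, pairingSum_comm W U, hULW]
  ring

end Energy

end LaneEmden

end

/-! ### The constant and the monotonicity -/

theorem theorem1p2 (n : ℕ) (hn : 5 ≤ n) (p : ℝ) (hp : ((n : ℝ) + 4) / ((n : ℝ) - 4) < p) :
    ∃ C : ℝ, 0 < C ∧
      ∀ (m : ℕ) (_ : 1 ≤ m) (u : LaneEmden.E n → LaneEmden.E m),
        LaneEmden.IsClassicalSolution p u →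
        ∀ x₀ : LaneEmden.E n,
          (∀ ρ : ℝ, 0 < ρ →
            -- the derivatives that occur in the definition of the energy exist
            DifferentiableAt ℝ (LaneEmden.massTerm p u x₀) ρ ∧
            DifferentiableAt ℝ (LaneEmden.defectTerm p u x₀) ρ ∧
            DifferentiableAt ℝ (LaneEmden.tangentialTerm p u x₀) ρ ∧
            -- the energy is differentiable, with the lower bound for its derivative
            DifferentiableAt ℝ (LaneEmden.energy₂ p u x₀) ρ ∧
            C * ρ ^ (8 / (p - 1) + 2 - (n : ℝ)) *
                LaneEmden.sphereIntegral x₀ ρ (LaneEmden.homogeneityDefect p u x₀)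
              ≤ deriv (LaneEmden.energy₂ p u x₀) ρ) ∧
          MonotoneOn (LaneEmden.energy₂ p u x₀) (Set.Ioi 0) := by
  have hn4 : (0 : ℝ) < n - 4 := by
    have : (5 : ℝ) ≤ n := by exact_mod_cast hn
    linarith
  rw [div_lt_iff₀ hn4] at hp
  have hp1 : 1 < p := by nlinarith
  obtain ⟨k, hk⟩ : ∃ k, 4 / (p - 1) = k := ⟨_, rfl⟩
  have hk0 : 0 < k := hk ▸ div_pos (by norm_num) (by linarith)
  -- Supercriticality in terms of `k`: `8 < (n - 4)(p - 1)` is `n + 4 < p(n - 4)`.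
  have hkn : 2 * k < n - 4 := by
    rw [← hk, ← mul_div_assoc, div_lt_iff₀ (by linarith)]
    linarith
  have h8 : 8 / (p - 1) = 2 * k := by rw [← hk]; ring
  have hn0 : 0 < n := by omega
  set C : ℝ := 2 * ((n : ℝ) - 2 - 2 * k - k * (k - ((n : ℝ) - 2))) with hC
  -- Here `n - 2 - 2k > 2`, and `k(k - (n - 2)) < 0` because `0 < k < n - 2`.
  have hCpos : 0 < C := by nlinarith
  refine ⟨C, hCpos, fun m _ u hu x₀ => ?_⟩
  have hmain : ∀ ρ : ℝ, 0 < ρ → DifferentiableAt ℝ (LaneEmden.energy₂ p u x₀) ρ ∧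
      C * ρ ^ (8 / (p - 1) + 2 - (n : ℝ)) *
          LaneEmden.sphereIntegral x₀ ρ (LaneEmden.homogeneityDefect p u x₀)
        ≤ deriv (LaneEmden.energy₂ p u x₀) ρ := by
    intro ρ hρ
    have hd := LaneEmden.hasDerivAt_energy₂ (x₀ := x₀) (by omega) hk hρ hp1 hu
    refine ⟨hd.differentiableAt, ?_⟩
    have e : ρ ^ (8 / (p - 1) + 2 - (n : ℝ)) *
        LaneEmden.sphereIntegral x₀ ρ (LaneEmden.homogeneityDefect p u x₀) =
        ρ⁻¹ * LaneEmden.pairingSum k x₀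
          (fun i => LaneEmden.scaleDeriv k x₀ (LaneEmden.comp u i))
          (fun i => LaneEmden.scaleDeriv k x₀ (LaneEmden.comp u i)) ρ := by
      rw [LaneEmden.rpow_mul_sphereIntegral hn0 hρ, h8,
        show 2 * k + 2 - 1 = 2 * k + 1 by ring, Real.rpow_add_one hρ.ne', mul_right_comm,
        LaneEmden.angularIntegral_homogeneityDefect hk (hu.contDiff.of_le (by norm_num)) hρ]
      field_simp
    rw [hd.deriv, mul_assoc, e, mul_left_comm]
    refine mul_le_mul_of_nonneg_left ?_ (inv_nonneg.2 hρ.le)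
    have h1 := LaneEmden.pairingSum_self_nonneg (k := k) (x₀ := x₀) (fun i =>
      LaneEmden.scaleDeriv k x₀ (LaneEmden.scaleDeriv k x₀ (LaneEmden.comp u i))) hρ.le
    have h2 : LaneEmden.pairingSum k x₀
        (fun i => LaneEmden.scaleDeriv k x₀ (LaneEmden.comp u i))
        (fun i => LaneEmden.sphLaplacian x₀ (LaneEmden.scaleDeriv k x₀ (LaneEmden.comp u i))) ρ
          ≤ 0 :=
      Finset.sum_nonpos fun i _ => LaneEmden.scaledPairing_sphLaplacian_nonpos
        (LaneEmden.contDiff_scaleDeriv (LaneEmden.contDiff_comp hu.contDiff i) (by norm_num)) hρ.le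
    linarith
  refine ⟨fun ρ hρ => ⟨?_, ?_, ?_, hmain ρ hρ⟩, ?_⟩
  · exact (LaneEmden.hasDerivAt_massTerm hn0 hk hρ
      (hu.contDiff.of_le (by norm_num))).differentiableAt
  · exact (LaneEmden.hasDerivAt_defectTerm hn0 hk hρ
      (hu.contDiff.of_le (by norm_num))).differentiableAt
  · exact (LaneEmden.hasDerivAt_tangentialTerm hn0 hk hρ hp1
      (hu.contDiff.of_le (by norm_num))).differentiableAt
  · refine monotoneOn_of_deriv_nonneg (convex_Ioi 0)
      (fun ρ hρ => (hmain ρ hρ).1.continuousAt.continuousWithinAt)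
      (fun ρ hρ => (hmain ρ (interior_subset hρ)).1.differentiableWithinAt) fun ρ hρ => ?_
    have hρ' : 0 < ρ := interior_subset hρ
    refine le_trans ?_ (hmain ρ hρ').2
    refine mul_nonneg (mul_nonneg hCpos.le (Real.rpow_nonneg hρ'.le _)) ?_
    exact mul_nonneg (pow_nonneg hρ'.le _) (LaneEmden.angularIntegral_nonneg
      (f := LaneEmden.homogeneityDefect p u x₀) (fun x => Finset.sum_nonneg fun i _ => sq_nonneg _) ρ)
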